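/- Let $n \ge 1$ and let $M$ be a smooth $n$-dimensional manifold (Hausdorff, second countable, without boundary). A \emph{folded volume form} on $M$ is a smooth $n$-form $\Omega$ which, as a section of $\Lambda^n T^*M$, is transverse to the zero section; its \emph{critical set} is its set of zeroes. Let $Z \subset M$ be a smooth embedded hypersurface with inclusion $i : Z \hookrightarrow M$, and let $\Omega_0, \Omega_1$ be two folded volume forms on $M$, both with critical set $Z$. Let $\operatorname{Diff}(M,Z)$ be the group of diffeomorphisms $\varphi$ of $M$ with $\varphi(Z) = Z$, endowed with the $C^\infty$ topology (uniform convergence of all derivatives in charts on compact sets), and let $\varphi$ be an element of the path component of the identity in $\operatorname{Diff}(M,Z)$ such that $\varphi^*\Omega_1 = \Omega_0$. Then $\Omega_0$ and $\Omega_1$ have the same class in the de Rham cohomology $H^n(M)$ and the same class in the relative de Rham cohomology $H^n(M,Z)$, where $H^\bullet(M,Z)$ is the cohomology of the complex $\Omega^p(M,Z) = \{\alpha \in \Omega^p(M) \mid i^*\alpha = 0\}$ with the exterior derivative. (Every $n$-form on $M$ is closed and has zero pullback to $Z$, so it has a class in both groups.) -/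

import Mathlib

open scoped Manifold ContDiff Topology
open Set Filter

namespace FoldedVolume

section Calculus
variable {E F : Type*} [NormedAddCommGroup E] [NormedSpace ℝ E]
  [NormedAddCommGroup F] [NormedSpace ℝ F]

theorem exists_leftInverse_toMultilinear (k : ℕ) :
    ∃ P : ContinuousMultilinearMap ℝ (fun _ : Fin k => E) ℝ →L[ℝ] E [⋀^Fin k]→L[ℝ] ℝ,
      ∀ α : E [⋀^Fin k]→L[ℝ] ℝ, P α.toContinuousMultilinearMap = α := by
  let L : ContinuousMultilinearMap ℝ (fun _ : Fin k => E) ℝ →ₗ[ℝ] E [⋀^Fin k]→L[ℝ] ℝ :=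
    { toFun := fun f => ContinuousMultilinearMap.alternatization f
      map_add' := fun f g => map_add _ f g
      map_smul' := fun c f => by
        ext v
        simp [ContinuousMultilinearMap.alternatization_apply_apply, Finset.mul_sum,
          Units.smul_def, mul_left_comm] }
  have hL : ∀ f, ‖L f‖ ≤ (k.factorial : ℝ) * ‖f‖ := by
    intro f
    refine ContinuousAlternatingMap.opNorm_le_bound _ (by positivity) fun v => ?_
    change ‖ContinuousMultilinearMap.alternatization f v‖ ≤ _
    rw [ContinuousMultilinearMap.alternatization_apply_apply]
    refine (norm_sum_le _ _).trans ?_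
    have h1 : ∀ σ ∈ (Finset.univ : Finset (Equiv.Perm (Fin k))),
        ‖Equiv.Perm.sign σ • f (v ∘ σ)‖ ≤ ‖f‖ * ∏ i, ‖v i‖ := by
      intro σ _
      have : ‖Equiv.Perm.sign σ • f (v ∘ σ)‖ = ‖f (v ∘ σ)‖ := by
        rcases Int.units_eq_one_or (Equiv.Perm.sign σ) with h | h <;> simp [h]
      rw [this]
      refine (f.le_opNorm _).trans (le_of_eq ?_)
      congr 1
      exact Equiv.prod_comp σ (fun i => ‖v i‖)
    refine (Finset.sum_le_card_nsmul _ _ _ h1).trans (le_of_eq ?_)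
    simp [Finset.card_univ, Fintype.card_perm, mul_assoc]
  refine ⟨((k.factorial : ℝ)⁻¹) • L.mkContinuous _ hL, fun α => ?_⟩
  ext v
  change ((k.factorial : ℝ)⁻¹) • ContinuousMultilinearMap.alternatization
    α.toContinuousMultilinearMap v = α v
  rw [ContinuousMultilinearMap.alternatization_apply_apply]
  have h1 : ∀ σ ∈ (Finset.univ : Finset (Equiv.Perm (Fin k))),
      Equiv.Perm.sign σ • α.toContinuousMultilinearMap (v ∘ σ) = α v := by
    intro σ _
    have := α.toAlternatingMap.map_perm v σ
    change Equiv.Perm.sign σ • α.toAlternatingMap (v ∘ σ) = α v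
    rw [this, smul_smul]
    simp
  rw [Finset.sum_congr rfl h1]
  have : (k.factorial : ℝ) ≠ 0 := by positivity
  simp [Finset.card_univ, Fintype.card_perm, this]

theorem contDiff_compContinuousLinearMap (k : ℕ) :
    ContDiff ℝ ∞ (fun p : (F [⋀^Fin k]→L[ℝ] ℝ) × (E →L[ℝ] F) =>
      p.1.compContinuousLinearMap p.2) := by
  obtain ⟨P, hP⟩ := exists_leftInverse_toMultilinear (E := E) k
  have h1 : ContDiff ℝ ∞ (fun p : (F [⋀^Fin k]→L[ℝ] ℝ) × (E →L[ℝ] F) =>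
      ContinuousMultilinearMap.compContinuousLinearMapContinuousMultilinear ℝ
        (fun _ : Fin k => E) (fun _ : Fin k => F) ℝ (fun _ => p.2)
        (ContinuousAlternatingMap.toContinuousMultilinearMapCLM ℝ p.1)) := by
    refine ContDiff.clm_apply ?_ ?_
    · exact (ContinuousMultilinearMap.contDiff _).comp (contDiff_pi.2 fun _ => contDiff_snd)
    · exact (ContinuousLinearMap.contDiff _).comp contDiff_fst
  have h2 := P.contDiff.comp h1
  have h3 : (fun p : (F [⋀^Fin k]→L[ℝ] ℝ) × (E →L[ℝ] F) => p.1.compContinuousLinearMap p.2) =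
      P ∘ fun p => ContinuousMultilinearMap.compContinuousLinearMapContinuousMultilinear ℝ
        (fun _ : Fin k => E) (fun _ : Fin k => F) ℝ (fun _ => p.2)
        (ContinuousAlternatingMap.toContinuousMultilinearMapCLM ℝ p.1) := by
    funext p
    exact (hP (p.1.compContinuousLinearMap p.2)).symm
  rw [h3]
  exact h2

theorem minSmoothness_two_le : minSmoothness ℝ 2 ≤ (∞ : WithTop ℕ∞) := by
  simpa using (show (2 : WithTop ℕ∞) ≤ ∞ from WithTop.coe_le_coe.2 (le_top : (2 : ℕ∞) ≤ ⊤))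

theorem contDiffOn_extDeriv {k : ℕ} {η : E → E [⋀^Fin k]→L[ℝ] ℝ} {s : Set E} (hs : IsOpen s)
    (h : ContDiffOn ℝ ∞ η s) : ContDiffOn ℝ ∞ (extDeriv η) s :=
  (ContinuousAlternatingMap.alternatizeUncurryFinCLM ℝ E ℝ).contDiff.comp_contDiffOn
    (h.fderiv_of_isOpen hs (by simp))
end Calculus

section Forms

variable {E : Type*} [NormedAddCommGroup E] [NormedSpace ℝ E]
  {E' : Type*} [NormedAddCommGroup E'] [NormedSpace ℝ E']
  {E'' : Type*} [NormedAddCommGroup E''] [NormedSpace ℝ E'']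
  {M : Type*} [TopologicalSpace M] [ChartedSpace E M]
  {N : Type*} [TopologicalSpace N] [ChartedSpace E' N]
  {P : Type*} [TopologicalSpace P] [ChartedSpace E'' P]

/-- A (not necessarily smooth) field of alternating `k`-forms on the tangent spaces of the manifold
`M` modelled on `E`. -/
def FormField (E : Type*) [NormedAddCommGroup E] [NormedSpace ℝ E]
    (M : Type*) [TopologicalSpace M] [ChartedSpace E M] (k : ℕ) : Type _ :=
  ∀ x : M, TangentSpace 𝓘(ℝ, E) x [⋀^Fin k]→L[ℝ] ℝ

noncomputable instance (k : ℕ) : AddCommGroup (FormField E M k) :=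
  inferInstanceAs (AddCommGroup (M → E [⋀^Fin k]→L[ℝ] ℝ))

noncomputable instance (k : ℕ) : Module ℝ (FormField E M k) :=
  inferInstanceAs (Module ℝ (M → E [⋀^Fin k]→L[ℝ] ℝ))

/-- The pullback `f^*α`, that is `(f^*α)_x (v₁, …, v_k) = α_{f x} (df_x v₁, …, df_x v_k)`. -/
noncomputable def FormField.pull {k : ℕ} (f : M → N) (α : FormField E' N k) : FormField E M k :=
  fun x => (α (f x)).compContinuousLinearMap (mfderiv 𝓘(ℝ, E) 𝓘(ℝ, E') f x)

/-- The coordinate expression of a form in the chart `e`: the pullback by `e⁻¹` (meaningful on the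
target of `e`). -/
noncomputable def FormField.rep {k : ℕ} (e : OpenPartialHomeomorph M E) (α : FormField E M k) :
    E → E [⋀^Fin k]→L[ℝ] ℝ :=
  FormField.pull (E := E) e.symm α

/-- The exterior derivative, computed at each point in the preferred chart there. -/
noncomputable def FormField.d {k : ℕ} (α : FormField E M k) : FormField E M (k + 1) :=
  fun x => (extDeriv (α.rep (chartAt E x)) (chartAt E x x)).compContinuousLinearMap
    (mfderiv 𝓘(ℝ, E) 𝓘(ℝ, E) (chartAt E x) x)

/-- A form is smooth if its coordinate expressions are. -/
def FormField.IsSmooth {k : ℕ} (α : FormField E M k) : Prop :=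
  ∀ x : M, ContDiffOn ℝ ∞ (α.rep (chartAt E x)) (chartAt E x).target

theorem FormField.pull_add {k : ℕ} (f : M → N) (α β : FormField E' N k) :
    (α + β).pull (E := E) f = α.pull f + β.pull f := rfl

theorem FormField.pull_smul {k : ℕ} (f : M → N) (c : ℝ) (α : FormField E' N k) :
    (c • α).pull (E := E) f = c • α.pull f := rfl

theorem FormField.pull_pull {k : ℕ} {g : N → P} {f : M → N} {x : M} (α : FormField E'' P k)
    (hg : MDifferentiableAt 𝓘(ℝ, E') 𝓘(ℝ, E'') g (f x))
    (hf : MDifferentiableAt 𝓘(ℝ, E) 𝓘(ℝ, E') f x) :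
    FormField.pull (E := E) f (FormField.pull (E := E') g α) x =
      FormField.pull (E := E) (g ∘ f) α x := by
  unfold FormField.pull
  rw [mfderiv_comp x hg hf]
  rfl

theorem FormField.pull_congr {k : ℕ} {f g : M → N} {x : M} (α : FormField E' N k)
    (h : f =ᶠ[𝓝 x] g) : α.pull (E := E) f x = α.pull g x := by
  unfold FormField.pull
  rw [h.mfderiv_eq, h.eq_of_nhds]

theorem FormField.IsSmooth.contDiffAt {k : ℕ} {α : FormField E M k} (hα : α.IsSmooth) (x : M)
    {y : E} (hy : y ∈ (chartAt E x).target) : ContDiffAt ℝ ∞ (α.rep (chartAt E x)) y :=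
  (hα x).contDiffAt ((chartAt E x).open_target.mem_nhds hy)

section
variable [IsManifold 𝓘(ℝ, E) ∞ M] [IsManifold 𝓘(ℝ, E') ∞ N]

theorem mdiffAt_chart (x : M) {y : M} (hy : y ∈ (chartAt E x).source) :
    MDifferentiableAt 𝓘(ℝ, E) 𝓘(ℝ, E) (chartAt E x) y :=
  ((contMDiffOn_chart (I := 𝓘(ℝ, E)) (n := ∞) (x := x)).contMDiffAt
    ((chartAt E x).open_source.mem_nhds hy)).mdifferentiableAt (by simp)

theorem mdiffAt_chart_symm (x : M) {y : E} (hy : y ∈ (chartAt E x).target) :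
    MDifferentiableAt 𝓘(ℝ, E) 𝓘(ℝ, E) (chartAt E x).symm y :=
  ((contMDiffOn_chart_symm (I := 𝓘(ℝ, E)) (n := ∞) (x := x)).contMDiffAt
    ((chartAt E x).open_target.mem_nhds hy)).mdifferentiableAt (by simp)

/-- The expression in charts of a smooth map, near a point where it makes sense. -/
theorem contDiffAt_inCharts {f : M → N} (hf : ContMDiff 𝓘(ℝ, E) 𝓘(ℝ, E') ∞ f) (x : M) (z : N)
    {y : E} (hy : y ∈ (chartAt E x).target)
    (hz : f ((chartAt E x).symm y) ∈ (chartAt E' z).source) :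
    ContDiffAt ℝ ∞ (chartAt E' z ∘ f ∘ (chartAt E x).symm) y := by
  rw [← contMDiffAt_iff_contDiffAt]
  have h1 := (contMDiffOn_chart_symm (I := 𝓘(ℝ, E)) (n := ∞) (x := x)).contMDiffAt
    ((chartAt E x).open_target.mem_nhds hy)
  have h2 := (contMDiffOn_chart (I := 𝓘(ℝ, E')) (n := ∞) (x := z)).contMDiffAt
    ((chartAt E' z).open_source.mem_nhds hz)
  exact ContMDiffAt.comp y h2 (ContMDiffAt.comp y hf.contMDiffAt h1)

/-- The coordinate expression of a pullback is the pullback of the coordinate expression. -/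
theorem FormField.rep_pull {k : ℕ} {f : M → N} (hf : ContMDiff 𝓘(ℝ, E) 𝓘(ℝ, E') ∞ f)
    (α : FormField E' N k) (x : M) (z : N)
    {y : E} (hy : y ∈ (chartAt E x).target)
    (hz : f ((chartAt E x).symm y) ∈ (chartAt E' z).source) :
    (α.pull (E := E) f).rep (chartAt E x) y =
      (α.rep (chartAt E' z) ((chartAt E' z ∘ f ∘ (chartAt E x).symm) y)).compContinuousLinearMap
        (fderiv ℝ (chartAt E' z ∘ f ∘ (chartAt E x).symm) y) := by
  have hτ : MDifferentiableAt 𝓘(ℝ, E) 𝓘(ℝ, E') (chartAt E' z ∘ f ∘ (chartAt E x).symm) y :=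
    ((contDiffAt_inCharts hf x z hy hz).differentiableAt (by simp)).mdifferentiableAt
  have hzt : (chartAt E' z ∘ f ∘ (chartAt E x).symm) y ∈ (chartAt E' z).target :=
    (chartAt E' z).map_source hz
  rw [← mfderiv_eq_fderiv]
  change FormField.pull (chartAt E x).symm (α.pull f) y =
    FormField.pull (chartAt E' z ∘ f ∘ (chartAt E x).symm)
      (FormField.pull (E := E') (chartAt E' z).symm α) y
  rw [FormField.pull_pull _ (hf.mdifferentiable (by simp) _) (mdiffAt_chart_symm x hy),
    FormField.pull_pull _ (mdiffAt_chart_symm z hzt) hτ]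
  refine FormField.pull_congr α ?_
  have hcont : ContinuousAt (f ∘ (chartAt E x).symm) y :=
    hf.continuous.continuousAt.comp ((chartAt E x).continuousAt_symm hy)
  filter_upwards [hcont.preimage_mem_nhds ((chartAt E' z).open_source.mem_nhds hz)] with w hw
  exact ((chartAt E' z).left_inv hw).symm

theorem FormField.rep_pull_eventually {k : ℕ} {f : M → N}
    (hf : ContMDiff 𝓘(ℝ, E) 𝓘(ℝ, E') ∞ f) (α : FormField E' N k) (x : M) (z : N)
    {y : E} (hy : y ∈ (chartAt E x).target)
    (hz : f ((chartAt E x).symm y) ∈ (chartAt E' z).source) :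
    (α.pull (E := E) f).rep (chartAt E x) =ᶠ[𝓝 y] fun w =>
      (α.rep (chartAt E' z) ((chartAt E' z ∘ f ∘ (chartAt E x).symm) w)).compContinuousLinearMap
        (fderiv ℝ (chartAt E' z ∘ f ∘ (chartAt E x).symm) w) := by
  have hcont : ContinuousAt (f ∘ (chartAt E x).symm) y :=
    hf.continuous.continuousAt.comp ((chartAt E x).continuousAt_symm hy)
  filter_upwards [hcont.preimage_mem_nhds ((chartAt E' z).open_source.mem_nhds hz),
    (chartAt E x).open_target.mem_nhds hy] with w hw hw'
  exact FormField.rep_pull hf α x z hw' hw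

theorem FormField.IsSmooth.pull {k : ℕ} {f : M → N} (hf : ContMDiff 𝓘(ℝ, E) 𝓘(ℝ, E') ∞ f)
    {α : FormField E' N k} (hα : α.IsSmooth) : (α.pull (E := E) f).IsSmooth := by
  intro x y hy
  set z := f ((chartAt E x).symm y) with hzdef
  have hz : f ((chartAt E x).symm y) ∈ (chartAt E' z).source := mem_chart_source E' z
  have hτ := contDiffAt_inCharts hf x z hy hz
  refine ContDiffAt.contDiffWithinAt ?_
  refine ContDiffAt.congr_of_eventuallyEq ?_ (FormField.rep_pull_eventually hf α x z hy hz)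
  have h1 : ContDiffAt ℝ ∞ (fun w => α.rep (chartAt E' z)
      ((chartAt E' z ∘ f ∘ (chartAt E x).symm) w)) y :=
    ContDiffAt.comp y (hα.contDiffAt z ((chartAt E' z).map_source hz)) hτ
  have h2 : ContDiffAt ℝ ∞ (fderiv ℝ (chartAt E' z ∘ f ∘ (chartAt E x).symm)) y :=
    hτ.fderiv_right (by simp)
  exact ((contDiff_compContinuousLinearMap k).contDiffAt).comp y (h1.prodMk h2)

/-- Chart-level naturality of the exterior derivative. -/
theorem FormField.extDeriv_rep_pull {k : ℕ} {f : M → N}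
    (hf : ContMDiff 𝓘(ℝ, E) 𝓘(ℝ, E') ∞ f) {α : FormField E' N k} (hα : α.IsSmooth)
    (x : M) (z : N) {y : E} (hy : y ∈ (chartAt E x).target)
    (hz : f ((chartAt E x).symm y) ∈ (chartAt E' z).source) :
    extDeriv ((α.pull (E := E) f).rep (chartAt E x)) y =
      (extDeriv (α.rep (chartAt E' z))
        ((chartAt E' z ∘ f ∘ (chartAt E x).symm) y)).compContinuousLinearMap
        (fderiv ℝ (chartAt E' z ∘ f ∘ (chartAt E x).symm) y) := by
  rw [(FormField.rep_pull_eventually hf α x z hy hz).extDeriv_eq]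
  refine extDeriv_pullback (r := ∞) ?_ (contDiffAt_inCharts hf x z hy hz)
    minSmoothness_two_le
  exact (hα.contDiffAt z ((chartAt E' z).map_source hz)).differentiableAt (by simp)

/-- In every chart of the preferred family the exterior derivative is the usual one. -/
theorem FormField.rep_d {k : ℕ} {α : FormField E M k} (hα : α.IsSmooth) (x : M)
    {y : E} (hy : y ∈ (chartAt E x).target) :
    α.d.rep (chartAt E x) y = extDeriv (α.rep (chartAt E x)) y := by
  set z := (chartAt E x).symm y with hzdef
  have hid : α.pull (E := E) (id : M → M) = α := by
    funext w
    unfold FormField.pull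
    rw [mfderiv_id]
    rfl
  have hz : id ((chartAt E x).symm y) ∈ (chartAt E z).source := mem_chart_source E z
  have h := FormField.extDeriv_rep_pull (contMDiff_id (I := 𝓘(ℝ, E)) (M := M)) hα x z hy hz
  rw [hid] at h
  rw [h, ← mfderiv_eq_fderiv]
  change _ = (extDeriv (α.rep (chartAt E z)) (chartAt E z z)).compContinuousLinearMap
    (mfderiv 𝓘(ℝ, E) 𝓘(ℝ, E) (chartAt E z ∘ (chartAt E x).symm) y)
  rw [mfderiv_comp y (mdiffAt_chart z hz) (mdiffAt_chart_symm x hy)]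
  rfl

theorem FormField.IsSmooth.d {k : ℕ} {α : FormField E M k} (hα : α.IsSmooth) :
    α.d.IsSmooth := fun x =>
  (contDiffOn_extDeriv (chartAt E x).open_target (hα x)).congr fun _ hy => FormField.rep_d hα x hy

theorem FormField.d_pull {k : ℕ} {f : M → N}
    (hf : ContMDiff 𝓘(ℝ, E) 𝓘(ℝ, E') ∞ f) {α : FormField E' N k} (hα : α.IsSmooth) :
    (α.pull (E := E) f).d = α.d.pull f := by
  funext x
  have hx := mem_chart_source E x
  have hxt := mem_chart_target E x
  have hl : (chartAt E x).symm (chartAt E x x) = x := (chartAt E x).left_inv hx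
  have hz : f ((chartAt E x).symm (chartAt E x x)) ∈ (chartAt E' (f x)).source := by
    rw [hl]; exact mem_chart_source E' (f x)
  have hτ : MDifferentiableAt 𝓘(ℝ, E) 𝓘(ℝ, E')
      (chartAt E' (f x) ∘ f ∘ (chartAt E x).symm) (chartAt E x x) :=
    ((contDiffAt_inCharts hf x (f x) hxt hz).differentiableAt (by simp)).mdifferentiableAt
  have h1 : mfderiv 𝓘(ℝ, E) 𝓘(ℝ, E')
      ((chartAt E' (f x) ∘ f ∘ (chartAt E x).symm) ∘ chartAt E x) x =
      mfderiv 𝓘(ℝ, E) 𝓘(ℝ, E') (chartAt E' (f x) ∘ f) x := by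
    refine Filter.EventuallyEq.mfderiv_eq ?_
    filter_upwards [(chartAt E x).open_source.mem_nhds hx] with w hw
    simp [(chartAt E x).left_inv hw]
  rw [mfderiv_comp x hτ (mdiffAt_chart x hx),
    mfderiv_comp x (mdiffAt_chart (f x) (mem_chart_source E' (f x)))
      (hf.mdifferentiable (by simp) x)] at h1
  have h2 := FormField.extDeriv_rep_pull hf hα x (f x) hxt hz
  have h3 : (chartAt E' (f x) ∘ f ∘ (chartAt E x).symm) (chartAt E x x) =
      chartAt E' (f x) (f x) := by simp [hl]
  rw [h3, ← mfderiv_eq_fderiv] at h2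
  unfold FormField.d
  rw [h2]
  ext v
  have h4 : ∀ u : TangentSpace 𝓘(ℝ, E) x, _ := fun u => DFunLike.congr_fun h1 u
  exact congrArg (extDeriv (α.rep (chartAt E' (f x))) (chartAt E' (f x) (f x)))
    (funext fun i => h4 (v i))

theorem FormField.d_d {k : ℕ} {α : FormField E M k} (hα : α.IsSmooth) : α.d.d = 0 := by
  funext x
  have hxt := mem_chart_target E x
  have h : α.d.rep (chartAt E x) =ᶠ[𝓝 (chartAt E x x)] extDeriv (α.rep (chartAt E x)) := by
    filter_upwards [(chartAt E x).open_target.mem_nhds hxt] with y hy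
    exact FormField.rep_d hα x hy
  unfold FormField.d
  change (extDeriv (α.d.rep (chartAt E x)) (chartAt E x x)).compContinuousLinearMap _ = 0
  rw [h.extDeriv_eq, extDeriv_extDeriv_apply (hα.contDiffAt x hxt) minSmoothness_two_le]
  rfl

end
end Forms

section Complexes

variable {E : Type*} [NormedAddCommGroup E] [NormedSpace ℝ E]
  {E' : Type*} [NormedAddCommGroup E'] [NormedSpace ℝ E']
  {M : Type*} [TopologicalSpace M] [ChartedSpace E M] [IsManifold 𝓘(ℝ, E) ∞ M]
  {N : Type*} [TopologicalSpace N] [ChartedSpace E' N] [IsManifold 𝓘(ℝ, E') ∞ N]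

/-- The space `Ω^k(M)` of smooth differential `k`-forms on the manifold `M` modelled on `E`. -/
def SmoothForm (E : Type*) [NormedAddCommGroup E] [NormedSpace ℝ E]
    (M : Type*) [TopologicalSpace M] [ChartedSpace E M] (k : ℕ) :
    Submodule ℝ (FormField E M k) where
  carrier := {α | α.IsSmooth}
  add_mem' := fun hα hβ x => (hα x).add (hβ x)
  zero_mem' := fun _ => contDiffOn_const (c := 0)
  smul_mem' := fun c _ hα x => (hα x).const_smul c

/-- The exterior derivative `d : Ω^k(M) → Ω^{k+1}(M)`. -/
noncomputable def extD (E : Type*) [NormedAddCommGroup E] [NormedSpace ℝ E]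
    (M : Type*) [TopologicalSpace M] [ChartedSpace E M] [IsManifold 𝓘(ℝ, E) ∞ M] (k : ℕ) :
    SmoothForm E M k →ₗ[ℝ] SmoothForm E M (k + 1) where
  toFun := fun α => ⟨FormField.d α.1, FormField.IsSmooth.d α.2⟩
  map_add' := fun α β => by
    refine Subtype.ext (funext fun x => ?_)
    have hx := mem_chart_target E x
    have h := extDeriv_add
      ((FormField.IsSmooth.contDiffAt α.2 x hx).differentiableAt (by simp))
      ((FormField.IsSmooth.contDiffAt β.2 x hx).differentiableAt (by simp))
    change (extDeriv (α.1.rep (chartAt E x) + β.1.rep (chartAt E x)) _).compContinuousLinearMap _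
      = _
    rw [h]
    rfl
  map_smul' := fun c α => by
    refine Subtype.ext (funext fun x => ?_)
    change (extDeriv (c • α.1.rep (chartAt E x)) _).compContinuousLinearMap _ = _
    rw [extDeriv_smul]
    rfl

theorem extD_extD {k : ℕ} (α : SmoothForm E M k) : extD E M (k + 1) (extD E M k α) = 0 :=
  Subtype.ext (FormField.d_d α.2)

/-- The pullback `f^* : Ω^k(N) → Ω^k(M)` by a smooth map `f : M → N`. -/
noncomputable def pullback {f : M → N} (hf : ContMDiff 𝓘(ℝ, E) 𝓘(ℝ, E') ∞ f) (k : ℕ) :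
    SmoothForm E' N k →ₗ[ℝ] SmoothForm E M k where
  toFun := fun α => ⟨FormField.pull f α.1, FormField.IsSmooth.pull hf α.2⟩
  map_add' := fun _ _ => rfl
  map_smul' := fun _ _ => rfl

theorem extD_pullback {f : M → N} (hf : ContMDiff 𝓘(ℝ, E) 𝓘(ℝ, E') ∞ f) {k : ℕ}
    (α : SmoothForm E' N k) :
    extD E M k (pullback hf k α) = pullback hf (k + 1) (extD E' N k α) :=
  Subtype.ext (FormField.d_pull hf α.2)

/-! ### De Rham cohomology -/

/-- The exact `k`-forms (only `0` in degree `0`). -/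
noncomputable def exactForms (E : Type*) [NormedAddCommGroup E] [NormedSpace ℝ E]
    (M : Type*) [TopologicalSpace M] [ChartedSpace E M] [IsManifold 𝓘(ℝ, E) ∞ M] :
    ∀ k : ℕ, Submodule ℝ (SmoothForm E M k)
  | 0 => ⊥
  | k + 1 => LinearMap.range (extD E M k)

/-- De Rham cohomology `H^k(M)`: closed `k`-forms modulo exact `k`-forms. -/
abbrev DeRham (E : Type*) [NormedAddCommGroup E] [NormedSpace ℝ E]
    (M : Type*) [TopologicalSpace M] [ChartedSpace E M] [IsManifold 𝓘(ℝ, E) ∞ M] (k : ℕ) :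
    Type _ :=
  LinearMap.ker (extD E M k) ⧸ (exactForms E M k).submoduleOf (LinearMap.ker (extD E M k))

/-- The de Rham class of a closed form. -/
noncomputable def deRhamClass {k : ℕ} (α : SmoothForm E M k) (hα : extD E M k α = 0) :
    DeRham E M k :=
  Submodule.Quotient.mk ⟨α, hα⟩

/-! ### Relative de Rham cohomology -/

/-- The relative forms `Ω^k(N, M) = {α ∈ Ω^k(N) | i^*α = 0}` for a smooth map `i : M → N`
(the inclusion of a submanifold). -/
noncomputable def RelForm {i : M → N} (hi : ContMDiff 𝓘(ℝ, E) 𝓘(ℝ, E') ∞ i) (k : ℕ) :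
    Submodule ℝ (SmoothForm E' N k) :=
  LinearMap.ker (pullback hi k)

theorem extD_mem_relForm {i : M → N} (hi : ContMDiff 𝓘(ℝ, E) 𝓘(ℝ, E') ∞ i) {k : ℕ}
    {α : SmoothForm E' N k} (hα : α ∈ RelForm hi k) : extD E' N k α ∈ RelForm hi (k + 1) := by
  change pullback hi (k + 1) (extD E' N k α) = 0
  rw [← extD_pullback, show pullback hi k α = 0 from hα, map_zero]

/-- The cocycles of the complex of relative forms: closed forms `α` with `i^*α = 0`. -/
noncomputable def relClosedForms {i : M → N} (hi : ContMDiff 𝓘(ℝ, E) 𝓘(ℝ, E') ∞ i) (k : ℕ) :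
    Submodule ℝ (SmoothForm E' N k) :=
  RelForm hi k ⊓ LinearMap.ker (extD E' N k)

/-- The coboundaries of the complex of relative forms: the forms `dβ` with `i^*β = 0`. -/
noncomputable def relExactForms {i : M → N} (hi : ContMDiff 𝓘(ℝ, E) 𝓘(ℝ, E') ∞ i) :
    ∀ k : ℕ, Submodule ℝ (SmoothForm E' N k)
  | 0 => ⊥
  | k + 1 => (RelForm hi k).map (extD E' N k)

/-- Relative de Rham cohomology: the cohomology of the complex of relative forms. -/
abbrev RelDeRham {i : M → N} (hi : ContMDiff 𝓘(ℝ, E) 𝓘(ℝ, E') ∞ i) (k : ℕ) : Type _ :=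
  relClosedForms hi k ⧸ (relExactForms hi k).submoduleOf (relClosedForms hi k)

/-- The relative class of a closed form whose pullback by `i` vanishes. -/
noncomputable def relDeRhamClass {i : M → N} (hi : ContMDiff 𝓘(ℝ, E) 𝓘(ℝ, E') ∞ i) {k : ℕ}
    (α : SmoothForm E' N k) (hα : extD E' N k α = 0) (hiα : pullback hi k α = 0) :
    RelDeRham hi k :=
  Submodule.Quotient.mk ⟨α, hiα, hα⟩

end Complexes

/-! ### Folded volume forms -/

section Folded

theorem smoothForm_eq_zero {E : Type*} [NormedAddCommGroup E] [NormedSpace ℝ E]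
    [FiniteDimensional ℝ E] {M : Type*} [TopologicalSpace M] [ChartedSpace E M] {k : ℕ} (hk : Module.finrank ℝ E < k)
    (α : SmoothForm E M k) : α = 0 := by
  refine Subtype.ext (funext fun x => ?_)
  refine ContinuousAlternatingMap.ext fun v => ?_
  refine (α.1 x).toAlternatingMap.map_linearDependent v fun hv => ?_
  have h : Fintype.card (Fin k) ≤ Module.finrank ℝ E :=
    LinearIndependent.fintype_card_le_finrank (M := E) hv
  simp at h
  omega

/-- The de Rham class of a form of top degree. -/
noncomputable def topClass {n : ℕ} {M : Type*} [TopologicalSpace M]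
    [ChartedSpace (EuclideanSpace ℝ (Fin n)) M] [IsManifold (𝓡 n) ∞ M]
    (Ω : SmoothForm (EuclideanSpace ℝ (Fin n)) M n) : DeRham (EuclideanSpace ℝ (Fin n)) M n :=
  deRhamClass Ω (smoothForm_eq_zero (by simp) _)

/-- The relative class of a form of top degree, relative to a manifold of codimension one. -/
noncomputable def topRelClass {n : ℕ} {M : Type*} [TopologicalSpace M]
    [ChartedSpace (EuclideanSpace ℝ (Fin (n + 1))) M] [IsManifold (𝓡 (n + 1)) ∞ M]
    {Z : Type*} [TopologicalSpace Z]
    [ChartedSpace (EuclideanSpace ℝ (Fin n)) Z] [IsManifold (𝓡 n) ∞ Z]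
    {i : Z → M} (hi : ContMDiff (𝓡 n) (𝓡 (n + 1)) ∞ i)
    (Ω : SmoothForm (EuclideanSpace ℝ (Fin (n + 1))) M (n + 1)) : RelDeRham hi (n + 1) :=
  relDeRhamClass hi Ω (smoothForm_eq_zero (by simp) _) (smoothForm_eq_zero (by simp) _)

/-- A folded volume form: a smooth form of top degree that is transverse to the zero section of
`Λ^n T^*M`. At a zero `p`, transversality says that the derivative at `p` of the coordinate
expression is onto the (one-dimensional) space of alternating `n`-forms. -/
def IsFolded {n : ℕ} {M : Type*} [TopologicalSpace M]
    [ChartedSpace (EuclideanSpace ℝ (Fin n)) M]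
    (Ω : SmoothForm (EuclideanSpace ℝ (Fin n)) M n) : Prop :=
  ∀ p : M, Ω.1 p = 0 → Function.Surjective
    (fderiv ℝ (Ω.1.rep (chartAt (EuclideanSpace ℝ (Fin n)) p))
      (chartAt (EuclideanSpace ℝ (Fin n)) p p))

/-- The set of zeroes of a form. -/
def criticalSet {n : ℕ} {M : Type*} [TopologicalSpace M]
    [ChartedSpace (EuclideanSpace ℝ (Fin n)) M]
    (Ω : SmoothForm (EuclideanSpace ℝ (Fin n)) M n) : Set M :=
  {p | Ω.1 p = 0}

end Folded

section Diff

variable {E : Type*} [NormedAddCommGroup E] [NormedSpace ℝ E]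
  {M : Type*} [TopologicalSpace M] [ChartedSpace E M]

/-- The diffeomorphisms `g` that map the compact set `K` into the domain of the chart `e'` and
whose coordinate expression in the charts `e`, `e'` is, together with its derivatives up to order
`r`, within `ε` of that of `f` on `K`. -/
def weakNhd (f : M ≃ₘ⟮𝓘(ℝ, E), 𝓘(ℝ, E)⟯ M) (e e' : OpenPartialHomeomorph M E) (K : Set M)
    (r : ℕ) (ε : ℝ) : Set (M ≃ₘ⟮𝓘(ℝ, E), 𝓘(ℝ, E)⟯ M) :=
  {g | (∀ x ∈ K, g x ∈ e'.source) ∧ ∀ j ≤ r, ∀ x ∈ K,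
    ‖iteratedFDeriv ℝ j (e' ∘ g ∘ e.symm) (e x) - iteratedFDeriv ℝ j (e' ∘ f ∘ e.symm) (e x)‖ < ε}

/-- The (weak, or compact-open) `C^∞` topology on `Diff(M)`: uniform convergence of all derivatives
in charts on compact sets. -/
noncomputable abbrev smoothTopology (E : Type*) [NormedAddCommGroup E] [NormedSpace ℝ E]
    (M : Type*) [TopologicalSpace M] [ChartedSpace E M] :
    TopologicalSpace (M ≃ₘ⟮𝓘(ℝ, E), 𝓘(ℝ, E)⟯ M) :=
  TopologicalSpace.generateFrom
    {U | ∃ (f : M ≃ₘ⟮𝓘(ℝ, E), 𝓘(ℝ, E)⟯ M) (e e' : OpenPartialHomeomorph M E) (K : Set M)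
      (r : ℕ) (ε : ℝ),
      e ∈ IsManifold.maximalAtlas 𝓘(ℝ, E) ∞ M ∧ e' ∈ IsManifold.maximalAtlas 𝓘(ℝ, E) ∞ M ∧
      IsCompact K ∧ K ⊆ e.source ∧ (∀ x ∈ K, f x ∈ e'.source) ∧ 0 < ε ∧
      U = weakNhd f e e' K r ε}

/-- `Diff(M, Z)`: the diffeomorphisms `φ` of `M` with `φ(Z) = Z`. -/
def DiffPair (E : Type*) [NormedAddCommGroup E] [NormedSpace ℝ E]
    {M : Type*} [TopologicalSpace M] [ChartedSpace E M] (Z : Set M) : Type _ :=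
  {φ : M ≃ₘ⟮𝓘(ℝ, E), 𝓘(ℝ, E)⟯ M // φ '' Z = Z}

/-- `Diff(M, Z)` carries the subspace topology of the `C^∞` topology. -/
noncomputable instance (Z : Set M) : TopologicalSpace (DiffPair E Z) :=
  (smoothTopology E M).induced fun φ => φ.1

/-- The identity element of `Diff(M, Z)`. -/
noncomputable def DiffPair.identity (E : Type*) [NormedAddCommGroup E] [NormedSpace ℝ E]
    {M : Type*} [TopologicalSpace M] [ChartedSpace E M] (Z : Set M) : DiffPair E Z :=
  ⟨Diffeomorph.refl 𝓘(ℝ, E) M ∞, by simp⟩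

end Diff

end FoldedVolume

/-!
The difference `Ω₀ - Ω₁ = φ^*Ω₁ - Ω₁` is shown to be `dβ` for a form `β` of degree `n` with
`i^*β = 0`; this gives both equalities of classes. The argument works for every form of top degree
and for a path `γ` in `Diff(M, Z)` that is merely continuous, so that no smoothing of the path is
needed: all that is used is the joint continuity of `(t, x) ↦ γ t x`
(`continuous_eval_of_continuous_smoothTopology`).

By a partition of unity the form may be taken with compact support in a slice chart `e`, in which it
reads `f · vol` and `Z` lies in the hyperplane `{x_0 = 0}` (`exists_slice_chart`,
`SmoothForm.exists_coordinate_function`). By compactness the path can be divided into steps such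
that two successive maps `g`, `g'` are close to each other over the support
(`continuous_symm_of_continuous`, `exists_uniform_step`), so that it remains to compare
`g^*(f · vol)` with `g'^*(f · vol)` in the coordinates of the slice chart
(`exists_primitive_of_close`).

This is done by replacing the coordinates of `g` by those of `g'` one at a time. Let `F_j` be a
primitive of `f` in the direction of `x_j`, and let `η_j = F_j · ι_j vol`, where `ι_j vol` is the
contraction of `vol` with the `j`-th basis vector; then `dη_j = f · vol`. If `p` and `p'` differ in
the `j`-th coordinate only, then `p'^*(f · vol) - p^*(f · vol) = d(p'^*η_j - p^*η_j)`. Since `η_j`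
does not involve `dx_j`, the form `p'^*η_j - p^*η_j` vanishes wherever `F_j ∘ p' = F_j ∘ p`, in
particular where the segment from `p` to `p'` misses the support of `f`. It is also a relative form:
for `j ≠ 0` because `ι_j vol` contains the factor `dx_0`, which vanishes on `Z`, and for `j = 0`
because `p = p'` on `Z`. See `exists_coord_primitive` and `exists_primitive_pullback_sub`.

The local primitives are supported in a locally finite family of sets and add up to `β`
(`exists_relative_primitive`).
-/

namespace FoldedVolume

/-! ### Primitives along a direction -/

open MeasureTheory in
/-- A compactly supported smooth function has a smooth primitive in any given direction, namely its
integral over the half-line that ends at the given point. -/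
theorem exists_contDiff_directional_primitive {E : Type*} [NormedAddCommGroup E] [NormedSpace ℝ E]
    {f : E → ℝ} (hf : ContDiff ℝ ∞ f) (hc : HasCompactSupport f) {e : E} (he : e ≠ 0) :
    ∃ F : E → ℝ, ContDiff ℝ ∞ F ∧
      ∀ (x : E) (c : ℝ), F (x + c • e) - F x = ∫ s in (0 : ℝ)..c, f (x + s • e) := by
  have hcont : ∀ x : E, Continuous fun s : ℝ => f (x + s • e) := fun x =>
    hf.continuous.comp (by fun_prop)
  obtain ⟨R, hR⟩ := hc.isCompact.isBounded.subset_closedBall (0 : E)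
  have hzero : ∀ (r : ℝ) (x : E), x ∈ Metric.ball (0 : E) r → ∀ s : ℝ,
      s ∉ Metric.closedBall (0 : ℝ) ((R + r) / ‖e‖) → f (x + s • e) = 0 := by
    intro r x hx s hs
    by_contra h
    have h1 := hR (subset_tsupport f h)
    rw [mem_closedBall_zero_iff] at h1
    rw [mem_ball_zero_iff] at hx
    rw [mem_closedBall_zero_iff, not_le, div_lt_iff₀ (norm_pos_iff.2 he), ← norm_smul] at hs
    have h2 : ‖s • e‖ ≤ ‖x + s • e‖ + ‖x‖ := by
      simpa using norm_sub_le (x + s • e) x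
    linarith
  have hint : ∀ x : E, Integrable fun s : ℝ => f (x + s • e) := by
    intro x
    refine (hcont x).integrable_of_hasCompactSupport
      (HasCompactSupport.intro (isCompact_closedBall (0 : ℝ) ((R + (‖x‖ + 1)) / ‖e‖)) ?_)
    exact fun s hs => hzero _ x (by simp) s hs
  refine ⟨fun x => ∫ s in Iic (0 : ℝ), f (x + s • e), ?_, ?_⟩
  · rw [contDiff_iff_contDiffAt]
    intro x
    have hx : x ∈ Metric.ball (0 : E) (‖x‖ + 1) := by simp
    have hg : ContDiff ℝ ∞ (fun q : E × ℝ => f (q.1 + q.2 • e)) :=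
      hf.comp (contDiff_fst.add (contDiff_snd.smul contDiff_const))
    -- The integral over the half-line is a convolution with the indicator of `(0, ∞)`.
    have key := contDiffOn_convolution_right_with_param_comp (n := ⊤) (μ := volume)
      (ContinuousLinearMap.lsmul ℝ ℝ)
      (s := Metric.ball (0 : E) (‖x‖ + 1)) (v := fun _ => (0 : ℝ)) contDiffOn_const
      (f := (Ioi (0 : ℝ)).indicator fun _ => (1 : ℝ)) (g := fun (x : E) (s : ℝ) => f (x + s • e))
      Metric.isOpen_ball (isCompact_closedBall _ _) (fun p s hp hs => hzero _ p hp s hs)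
      ((locallyIntegrable_const (1 : ℝ)).indicator measurableSet_Ioi) hg.contDiffOn
    refine ((key x hx).contDiffAt (Metric.isOpen_ball.mem_nhds hx)).congr_of_eventuallyEq
      (Eventually.of_forall fun y => ?_)
    have h1 : (fun t : ℝ => (ContinuousLinearMap.lsmul ℝ ℝ)
        ((Ioi (0 : ℝ)).indicator (fun _ => (1 : ℝ)) t) (f (y + (0 - t) • e))) =
        (Ioi (0 : ℝ)).indicator fun t => f (y + (-t) • e) := by
      funext t
      by_cases ht : t ∈ Ioi (0 : ℝ) <;> simp [indicator, ht]
    change _ = ∫ t, _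
    rw [h1, integral_indicator measurableSet_Ioi,
      integral_comp_neg_Ioi (0 : ℝ) (fun s => f (y + s • e)), neg_zero]
  · intro x c
    have h1 : ∫ s in Iic (0 : ℝ), f (x + c • e + s • e) = ∫ s in Iic c, f (x + s • e) := by
      have h2 := integral_indicator (μ := volume) (f := fun s => f (x + s • e))
        (measurableSet_Iic (a := c))
      have h3 := integral_indicator (μ := volume) (f := fun s => f (x + c • e + s • e))
        (measurableSet_Iic (a := (0 : ℝ)))
      have h4 := integral_add_right_eq_self (μ := volume)
        ((Iic c).indicator fun s => f (x + s • e)) c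
      rw [← h2, ← h3, ← h4]
      congr 1
      funext s
      simp only [indicator, mem_Iic, add_le_iff_nonpos_left]
      rw [add_smul, add_assoc, add_comm (c • e)]
    change (∫ s in Iic (0 : ℝ), f (x + c • e + s • e)) - _ = _
    rw [h1]
    exact intervalIntegral.integral_Iic_sub_Iic (hint x).integrableOn (hint x).integrableOn

theorem fderiv_of_directional_primitive {E : Type*} [NormedAddCommGroup E] [NormedSpace ℝ E]
    {f F : E → ℝ} (hf : Continuous f) (hF : Differentiable ℝ F) {e : E}
    (h : ∀ (x : E) (c : ℝ), F (x + c • e) - F x = ∫ s in (0 : ℝ)..c, f (x + s • e)) (x : E) :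
    fderiv ℝ F x e = f x := by
  have h1 : HasDerivAt (fun c : ℝ => F (x + c • e)) (fderiv ℝ F x e) 0 := by
    have h2 : HasDerivAt (fun c : ℝ => x + c • e) e 0 := by
      simpa using ((hasDerivAt_id (0 : ℝ)).smul_const e).const_add x
    have h3 : HasFDerivAt F (fderiv ℝ F x) (x + (0 : ℝ) • e) := by
      simpa using (hF x).hasFDerivAt
    exact h3.comp_hasDerivAt 0 h2
  have h4 : HasDerivAt (fun c : ℝ => F (x + c • e)) (f x) 0 := by
    have h5 : (fun c : ℝ => F (x + c • e)) =
        fun c => (∫ s in (0 : ℝ)..c, f (x + s • e)) + F x := by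
      funext c
      rw [← h x c]; ring
    rw [h5]
    have hc : Continuous fun s : ℝ => f (x + s • e) := hf.comp (by fun_prop)
    have h6 := (hc.integral_hasStrictDerivAt 0 0).hasDerivAt.add_const (F x)
    simpa using h6
  exact h1.unique h4

/-! ### Locality and coordinate expressions of forms -/

section Local

variable {E : Type*} [NormedAddCommGroup E] [NormedSpace ℝ E]
  {M : Type*} [TopologicalSpace M] [ChartedSpace E M]

theorem FormField.rep_eventuallyEq {k : ℕ} {α β : FormField E M k} (e : OpenPartialHomeomorph M E)
    {y : E} (hy : y ∈ e.target) (h : ∀ᶠ x in 𝓝 (e.symm y), α x = β x) :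
    α.rep e =ᶠ[𝓝 y] β.rep e := by
  filter_upwards [(e.continuousAt_symm hy).eventually h] with w hw
  unfold FormField.rep FormField.pull
  rw [hw]

theorem FormField.isSmooth_of_eventually_eq {k : ℕ} {α : FormField E M k}
    (h : ∀ x, ∃ β : FormField E M k, β.IsSmooth ∧ ∀ᶠ y in 𝓝 x, α y = β y) : α.IsSmooth := by
  intro x y hy
  obtain ⟨β, hβ, hαβ⟩ := h ((chartAt E x).symm y)
  exact ((hβ.contDiffAt x hy).congr_of_eventuallyEq
    (FormField.rep_eventuallyEq _ hy hαβ)).contDiffWithinAt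

theorem FormField.d_congr {k : ℕ} {α β : FormField E M k} {x : M}
    (h : ∀ᶠ y in 𝓝 x, α y = β y) : α.d x = β.d x := by
  unfold FormField.d
  rw [(FormField.rep_eventuallyEq (chartAt E x) (mem_chart_target E x)
    (by rwa [(chartAt E x).left_inv (mem_chart_source E x)])).extDeriv_eq]

theorem FormField.pull_id {k : ℕ} (α : FormField E M k) : α.pull (E := E) (id : M → M) = α := by
  funext x
  unfold FormField.pull
  rw [mfderiv_id]
  rfl

/-- A form is recovered from its coordinate expression. -/
theorem FormField.pull_rep {k : ℕ} {e : OpenPartialHomeomorph M E}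
    (he : ContMDiffOn 𝓘(ℝ, E) 𝓘(ℝ, E) ∞ e e.source)
    (hes : ContMDiffOn 𝓘(ℝ, E) 𝓘(ℝ, E) ∞ e.symm e.target) (α : FormField E M k) {x : M}
    (hx : x ∈ e.source) : FormField.pull (M := M) e (α.rep e) x = α x := by
  unfold FormField.rep
  rw [FormField.pull_pull (g := e.symm) (f := e) α
    ((hes.contMDiffAt (e.open_target.mem_nhds (e.map_source hx))).mdifferentiableAt (by simp))
    ((he.contMDiffAt (e.open_source.mem_nhds hx)).mdifferentiableAt (by simp)),
    FormField.pull_congr (g := id) α ?_, FormField.pull_id]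
  filter_upwards [e.open_source.mem_nhds hx] with w hw
  exact e.left_inv hw

theorem SmoothForm.sum_apply {k : ℕ} {ι : Type*} (I : Finset ι) (α : ι → SmoothForm E M k)
    (x : M) : (∑ p ∈ I, α p).1 x = ∑ p ∈ I, (α p).1 x := by
  rw [AddSubmonoidClass.coe_finsetSum]
  exact Finset.sum_apply (M := fun x : M => TangentSpace 𝓘(ℝ, E) x [⋀^Fin k]→L[ℝ] ℝ) x I
    fun p => (α p).1

theorem FormField.rep_self {k : ℕ} (η : FormField E E k) (x : E) : η.rep (chartAt E x) = η :=
  FormField.pull_id η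

/-- The form on a vector space given by a smooth function with values in alternating maps. -/
def SmoothForm.ofContDiff {k : ℕ} (η : E → E [⋀^Fin k]→L[ℝ] ℝ) (hη : ContDiff ℝ ∞ η) :
    SmoothForm E E k :=
  ⟨η, fun x => by
    have h : FormField.rep (M := E) (chartAt E x) η = η := FormField.rep_self η x
    rw [h]
    exact hη.contDiffOn⟩

/-- On a vector space the exterior derivative of smooth forms is the usual one. -/
theorem SmoothForm.extD_ofContDiff {k : ℕ} (η : E → E [⋀^Fin k]→L[ℝ] ℝ) (hη : ContDiff ℝ ∞ η)
    {ζ : E → E [⋀^Fin (k + 1)]→L[ℝ] ℝ} (hζ : ContDiff ℝ ∞ ζ) (h : ∀ x, extDeriv η x = ζ x) :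
    extD E E k (SmoothForm.ofContDiff η hη) = SmoothForm.ofContDiff ζ hζ := by
  refine Subtype.ext (funext fun x => ?_)
  change (extDeriv (FormField.rep (M := E) (chartAt E x) η) _).compContinuousLinearMap
    (mfderiv 𝓘(ℝ, E) 𝓘(ℝ, E) id x) = ζ x
  have hr : FormField.rep (M := E) (chartAt E x) η = η := FormField.rep_self η x
  rw [hr, mfderiv_id, ← h]
  rfl

end Local

/-! ### The standard volume form and its contractions -/

section Volume

variable {n : ℕ}

/-- The standard volume form of `ℝⁿ`. -/
noncomputable def stdVol (n : ℕ) : EuclideanSpace ℝ (Fin n) [⋀^Fin n]→L[ℝ] ℝ :=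
  { (EuclideanSpace.basisFun (Fin n) ℝ).toBasis.det with
    cont := by
      change Continuous fun v => (EuclideanSpace.basisFun (Fin n) ℝ).toBasis.det v
      simp only [Module.Basis.det_apply]
      refine Continuous.matrix_det (continuous_matrix fun i j => ?_)
      simp only [Module.Basis.toMatrix_apply, OrthonormalBasis.coe_toBasis_repr_apply,
        EuclideanSpace.basisFun_repr]
      fun_prop }

/-- A form of top degree is its value on the standard basis times the standard volume form. -/
theorem eq_smul_stdVol (α : EuclideanSpace ℝ (Fin n) [⋀^Fin n]→L[ℝ] ℝ) :
    α = α (fun i => EuclideanSpace.single i 1) • stdVol n := by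
  have h := α.toAlternatingMap.eq_smul_basis_det (EuclideanSpace.basisFun (Fin n) ℝ).toBasis
  ext v
  have h2 := DFunLike.congr_fun h v
  rw [OrthonormalBasis.coe_toBasis, show ⇑(EuclideanSpace.basisFun (Fin n) ℝ) =
    fun i => EuclideanSpace.single i (1 : ℝ) from funext fun i => by simp] at h2
  exact h2

theorem stdVol_basis : stdVol n (fun i => EuclideanSpace.single i 1) = 1 := by
  have h := (EuclideanSpace.basisFun (Fin n) ℝ).toBasis.det_self
  rw [OrthonormalBasis.coe_toBasis, show ⇑(EuclideanSpace.basisFun (Fin n) ℝ) =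
    fun i => EuclideanSpace.single i (1 : ℝ) from funext fun i => by simp] at h
  exact h

/-- The projection of `ℝⁿ` along the `j`-th coordinate axis. -/
noncomputable def coordProj (j : Fin n) :
    EuclideanSpace ℝ (Fin n) →L[ℝ] EuclideanSpace ℝ (Fin n) :=
  ContinuousLinearMap.id ℝ _ -
    (EuclideanSpace.proj j).smulRight (EuclideanSpace.single j (1 : ℝ))

theorem coordProj_apply (j : Fin n) (v : EuclideanSpace ℝ (Fin n)) :
    coordProj j v = v - v j • EuclideanSpace.single j (1 : ℝ) := by
  simp [coordProj]

/-- The contraction of the standard volume form with the `j`-th basis vector. The projection makes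
it evident that it does not involve the `j`-th coordinate. -/
noncomputable def coordContraction (j : Fin (n + 1)) :
    EuclideanSpace ℝ (Fin (n + 1)) [⋀^Fin n]→L[ℝ] ℝ :=
  ((stdVol (n + 1)).curryLeft (EuclideanSpace.single j 1)).compContinuousLinearMap (coordProj j)

theorem coordContraction_apply (j : Fin (n + 1)) (v : Fin n → EuclideanSpace ℝ (Fin (n + 1))) :
    coordContraction j v =
      stdVol (n + 1) (Matrix.vecCons (EuclideanSpace.single j 1) fun i => coordProj j (v i)) := rfl

theorem coordContraction_comp_congr {E : Type*} [NormedAddCommGroup E] [NormedSpace ℝ E]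
    {j : Fin (n + 1)} {A B : E →L[ℝ] EuclideanSpace ℝ (Fin (n + 1))} {c : E →L[ℝ] ℝ}
    (h : B = A + c.smulRight (EuclideanSpace.single j 1)) :
    (coordContraction j).compContinuousLinearMap B =
      (coordContraction j).compContinuousLinearMap A := by
  ext v
  change coordContraction j (fun i => B (v i)) = coordContraction j (fun i => A (v i))
  rw [coordContraction_apply, coordContraction_apply]
  congr 2
  funext i
  rw [h, coordProj_apply, coordProj_apply]
  simp [add_smul]

/-- The contraction vanishes on a hyperplane `{x_l = 0}` that contains the direction of
contraction. -/
theorem coordContraction_eq_zero {j l : Fin (n + 1)} (hjl : j ≠ l)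
    {v : Fin n → EuclideanSpace ℝ (Fin (n + 1))} (hv : ∀ i, v i l = 0) :
    coordContraction j v = 0 := by
  rw [coordContraction_apply]
  refine (stdVol (n + 1)).toAlternatingMap.map_linearDependent _ fun hli => ?_
  have hsub : Submodule.span ℝ (range (Matrix.vecCons (EuclideanSpace.single j (1 : ℝ))
      fun i => coordProj j (v i))) ≤
      (EuclideanSpace.proj l : EuclideanSpace ℝ (Fin (n + 1)) →L[ℝ] ℝ).ker := by
    rw [Submodule.span_le]
    rintro _ ⟨i, rfl⟩
    refine Fin.cases ?_ (fun i => ?_) i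
    · simp [hjl.symm]
    · simp [coordProj_apply, hv i, hjl.symm]
  have htop := hli.span_eq_top_of_card_eq_finrank (by simp)
  rw [htop] at hsub
  have := hsub (Submodule.mem_top (x := EuclideanSpace.single l (1 : ℝ)))
  simp at this

/-- The derivatives of `F` in the directions other than `j` do not contribute, as the contraction
vanishes on the `j`-th basis vector. -/
theorem extDeriv_smul_coordContraction {F : EuclideanSpace ℝ (Fin (n + 1)) → ℝ}
    {x : EuclideanSpace ℝ (Fin (n + 1))} (hF : DifferentiableAt ℝ F x) (j : Fin (n + 1)) :
    extDeriv (fun y => F y • coordContraction j) x =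
      fderiv ℝ F x (EuclideanSpace.single j 1) • stdVol (n + 1) := by
  rw [eq_smul_stdVol (extDeriv _ x)]
  congr 1
  rw [extDeriv_apply (hF.smul_const _)]
  have hterm : ∀ i : Fin (n + 1), fderiv ℝ (fun y => (F y • coordContraction j)
      (i.removeNth fun i => EuclideanSpace.single i (1 : ℝ))) x (EuclideanSpace.single i 1) =
      fderiv ℝ F x (EuclideanSpace.single i 1) *
        coordContraction j (i.removeNth fun i => EuclideanSpace.single i (1 : ℝ)) := by
    intro i
    simp only [ContinuousAlternatingMap.smul_apply, smul_eq_mul]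
    rw [fderiv_mul_const hF]
    simp [mul_comm]
  simp only [hterm]
  rw [Finset.sum_eq_single j]
  · have h1 : (Matrix.vecCons (EuclideanSpace.single j (1 : ℝ)) fun i => coordProj j
        ((j.removeNth fun i => EuclideanSpace.single i (1 : ℝ)) i)) =
        Matrix.vecCons (EuclideanSpace.single j (1 : ℝ))
          (j.removeNth fun i => EuclideanSpace.single i (1 : ℝ)) := by
      congr 1
      funext i
      simp [coordProj_apply, Fin.removeNth]
    have h2 : coordContraction j (j.removeNth fun i => EuclideanSpace.single i (1 : ℝ)) =
        (-1 : ℝ) ^ j.val := by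
      rw [coordContraction_apply, h1, ← (stdVol (n + 1)).neg_one_pow_smul_map_insertNth j]
      erw [Fin.insertNth_self_removeNth j fun i => EuclideanSpace.single i (1 : ℝ)]
      rw [stdVol_basis]
      simp
    rw [h2, zsmul_eq_mul]
    push_cast
    rw [mul_left_comm, ← mul_pow]
    simp
  · intro i _ hij
    obtain ⟨m, hm⟩ := Fin.exists_succAbove_eq hij.symm
    have h0 : coordContraction j (i.removeNth fun i => EuclideanSpace.single i (1 : ℝ)) = 0 := by
      rw [coordContraction_apply]
      refine (stdVol (n + 1)).toAlternatingMap.map_coord_zero m.succ ?_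
      simp [Fin.removeNth, hm, coordProj_apply]
    rw [h0]; simp
  · simp

end Volume

/-! ### Changing a map one coordinate at a time -/

section Moves

variable {n : ℕ}

theorem contDiff_smul_stdVol {f : EuclideanSpace ℝ (Fin n) → ℝ} (hf : ContDiff ℝ ∞ f) :
    ContDiff ℝ ∞ fun x => f x • stdVol n :=
  hf.smul contDiff_const

/-- A primitive of a compactly supported form `f · vol` adapted to the `j`-th coordinate. Its
pullback is unchanged under moves in the direction of the `j`-th coordinate along which `f` has
integral zero. -/
theorem exists_coord_primitive {f : EuclideanSpace ℝ (Fin (n + 1)) → ℝ} (hf : ContDiff ℝ ∞ f)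
    (hc : HasCompactSupport f) (j : Fin (n + 1)) :
    ∃ η : SmoothForm (EuclideanSpace ℝ (Fin (n + 1))) (EuclideanSpace ℝ (Fin (n + 1))) n,
      extD _ _ n η = SmoothForm.ofContDiff _ (contDiff_smul_stdVol hf) ∧
      (∀ (y : EuclideanSpace ℝ (Fin (n + 1))) (c : ℝ)
        (A B : EuclideanSpace ℝ (Fin (n + 1)) →L[ℝ] EuclideanSpace ℝ (Fin (n + 1)))
        (φ : EuclideanSpace ℝ (Fin (n + 1)) →L[ℝ] ℝ),
        (∫ s in (0 : ℝ)..c, f (y + s • EuclideanSpace.single j (1 : ℝ))) = 0 →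
        B = A + φ.smulRight (EuclideanSpace.single j 1) →
        (η.1 (y + c • EuclideanSpace.single j (1 : ℝ))).compContinuousLinearMap B =
          (η.1 y).compContinuousLinearMap A) ∧
      ∀ (y : EuclideanSpace ℝ (Fin (n + 1))) (l : Fin (n + 1))
        (v : Fin n → EuclideanSpace ℝ (Fin (n + 1))), j ≠ l → (∀ i, v i l = 0) → η.1 y v = 0 := by
  obtain ⟨F, hF, hFf⟩ := exists_contDiff_directional_primitive hf hc
    (e := EuclideanSpace.single j (1 : ℝ)) (by simp)
  have hFd : Differentiable ℝ F := hF.differentiable (by simp)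
  refine ⟨SmoothForm.ofContDiff (fun x => F x • coordContraction j) (hF.smul contDiff_const),
    ?_, ?_, ?_⟩
  · refine SmoothForm.extD_ofContDiff _ _ _ fun x => ?_
    rw [extDeriv_smul_coordContraction (hFd x),
      fderiv_of_directional_primitive hf.continuous hFd hFf]
  · intro y c A B φ h0 hB
    have h1 : F (y + c • EuclideanSpace.single j (1 : ℝ)) = F y := by
      rw [← sub_eq_zero, hFf, h0]
    have h2 := coordContraction_comp_congr hB
    ext v
    have h3 := DFunLike.congr_fun h2 v
    change F _ • (coordContraction j).compContinuousLinearMap B v =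
      F y • (coordContraction j).compContinuousLinearMap A v
    rw [h1, h3]
  · intro y l v hjl hv
    change F y • coordContraction j v = 0
    rw [coordContraction_eq_zero hjl hv, smul_zero]

/-- The vector with the first `m` coordinates of `v`, all others being zero. -/
noncomputable def firstCoords (m : ℕ) (v : EuclideanSpace ℝ (Fin n)) : EuclideanSpace ℝ (Fin n) :=
  WithLp.toLp 2 fun i => if i.val < m then v i else 0

theorem firstCoords_apply (m : ℕ) (v : EuclideanSpace ℝ (Fin n)) (i : Fin n) :
    firstCoords m v i = if i.val < m then v i else 0 := rfl

theorem firstCoords_succ (j : Fin n) (v : EuclideanSpace ℝ (Fin n)) :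
    firstCoords (j.val + 1) v = firstCoords j.val v + v j • EuclideanSpace.single j (1 : ℝ) := by
  ext i
  rcases lt_trichotomy i j with h | h | h
  · have h1 : i.val < j.val := h
    simp [firstCoords_apply, h1, h1.trans (Nat.lt_succ_self _), h.ne]
  · simp [firstCoords_apply, h]
  · have h1 : j.val < i.val := h
    simp [firstCoords_apply, h1.not_gt, show ¬ i.val < j.val + 1 by omega, h.ne']

theorem norm_firstCoords_add_le (j : Fin n) (v : EuclideanSpace ℝ (Fin n)) {s : ℝ}
    (hs : s ∈ uIcc 0 (v j)) :
    ‖firstCoords j.val v + s • EuclideanSpace.single j (1 : ℝ)‖ ≤ ‖v‖ := by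
  have hs' : |s| ≤ |v j| := by simpa using abs_sub_left_of_mem_uIcc hs
  rw [EuclideanSpace.norm_eq, EuclideanSpace.norm_eq]
  refine Real.sqrt_le_sqrt (Finset.sum_le_sum fun i _ => ?_)
  refine pow_le_pow_left₀ (norm_nonneg _) ?_ 2
  by_cases h : i = j
  · subst h
    simpa [firstCoords_apply] using hs'
  · by_cases h1 : i.val < j.val <;> simp [firstCoords_apply, h, h1]

theorem contDiff_firstCoords (m : ℕ) : ContDiff ℝ ∞ (firstCoords (n := n) m) := by
  rw [contDiff_euclidean]
  intro i
  by_cases h : i.val < m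
  · simp only [firstCoords_apply, h, if_true]
    fun_prop
  · simp only [firstCoords_apply, h, if_false]
    exact contDiff_const

variable {M : Type*} [TopologicalSpace M] [ChartedSpace (EuclideanSpace ℝ (Fin (n + 1))) M]
  [IsManifold (𝓡 (n + 1)) ∞ M]
  {E' : Type*} [NormedAddCommGroup E'] [NormedSpace ℝ E']
  {N : Type*} [TopologicalSpace N] [ChartedSpace E' N] [IsManifold 𝓘(ℝ, E') ∞ N]

/-- Replacing the map `p` by `p + D` one coordinate at a time changes the pullback of `f · vol` by
an explicit exact form. -/
theorem exists_primitive_pullback_sub {f : EuclideanSpace ℝ (Fin (n + 1)) → ℝ}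
    (hf : ContDiff ℝ ∞ f) (hc : HasCompactSupport f) {p D : M → EuclideanSpace ℝ (Fin (n + 1))}
    (hp : ContMDiff (𝓡 (n + 1)) 𝓘(ℝ, EuclideanSpace ℝ (Fin (n + 1))) ∞ p)
    (hD : ContMDiff (𝓡 (n + 1)) 𝓘(ℝ, EuclideanSpace ℝ (Fin (n + 1))) ∞ D)
    {i : N → M} (hi : ContMDiff 𝓘(ℝ, E') (𝓡 (n + 1)) ∞ i)
    (hpi : ∀ z, p (i z) 0 = 0) (hDi : ∀ z, D (i z) 0 = 0) :
    ∃ β : SmoothForm (EuclideanSpace ℝ (Fin (n + 1))) M n,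
      extD _ M n β =
        pullback (hp.add hD) (n + 1) (SmoothForm.ofContDiff _ (contDiff_smul_stdVol hf)) -
        pullback hp (n + 1) (SmoothForm.ofContDiff _ (contDiff_smul_stdVol hf)) ∧
      pullback hi n β = 0 ∧
      ∀ x, (D x = 0 ∨ ∀ y, ‖y - p x‖ ≤ ‖D x‖ → f y = 0) → β.1 x = 0 := by
  set W := SmoothForm.ofContDiff _ (contDiff_smul_stdVol hf) with hW
  choose η hη1 hη2 hη3 using fun j => exists_coord_primitive hf hc j
  let q : ℕ → M → EuclideanSpace ℝ (Fin (n + 1)) := fun m x => p x + firstCoords m (D x)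
  have hq : ∀ m, ContMDiff (𝓡 (n + 1)) 𝓘(ℝ, EuclideanSpace ℝ (Fin (n + 1))) ∞ (q m) := fun m =>
    hp.add ((contDiff_firstCoords m).contMDiff.comp hD)
  have hqi : ∀ m z, q m (i z) 0 = 0 := by
    intro m z
    simp [q, hpi z, hDi z, firstCoords_apply]
  have hq0 : q 0 = p := by
    funext x
    ext l
    simp [q, firstCoords_apply]
  have hqn : q (n + 1) = p + D := by
    funext x
    ext l
    simp [q, firstCoords_apply, l.isLt]
  have hqs : ∀ (j : Fin (n + 1)) x,
      q (j.val + 1) x = q j.val x + D x j • EuclideanSpace.single j (1 : ℝ) := by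
    intro j x
    simp only [q, firstCoords_succ, add_assoc]
  have hDj : ∀ j : Fin (n + 1), ContMDiff (𝓡 (n + 1)) 𝓘(ℝ, ℝ) ∞ fun x => D x j := fun j =>
    (EuclideanSpace.proj (𝕜 := ℝ) j).contMDiff.comp hD
  let A : (M → EuclideanSpace ℝ (Fin (n + 1))) → M →
      EuclideanSpace ℝ (Fin (n + 1)) →L[ℝ] EuclideanSpace ℝ (Fin (n + 1)) := fun g x =>
    mfderiv (𝓡 (n + 1)) 𝓘(ℝ, EuclideanSpace ℝ (Fin (n + 1))) g x
  have hmf : ∀ (j : Fin (n + 1)) x, ∃ φ : EuclideanSpace ℝ (Fin (n + 1)) →L[ℝ] ℝ,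
      A (q (j.val + 1)) x = A (q j.val) x + φ.smulRight (EuclideanSpace.single j (1 : ℝ)) := by
    intro j x
    have h1 := ((hq j.val).mdifferentiable (by simp) x).hasMFDerivAt
    have h2 := ((hDj j).mdifferentiable (by simp) x).hasMFDerivAt
    have h3 : HasMFDerivAt 𝓘(ℝ, ℝ) 𝓘(ℝ, EuclideanSpace ℝ (Fin (n + 1)))
        (fun t : ℝ => t • EuclideanSpace.single j (1 : ℝ)) (D x j)
        ((ContinuousLinearMap.id ℝ ℝ).smulRight (EuclideanSpace.single j (1 : ℝ))) :=
      ((hasFDerivAt_id (D x j)).smul_const _).hasMFDerivAt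
    have h4 := h1.add (h3.comp x h2)
    have h5 : q (j.val + 1) = q j.val +
        (fun t : ℝ => t • EuclideanSpace.single j (1 : ℝ)) ∘ fun x => D x j := by
      funext y
      exact hqs j y
    refine ⟨mfderiv (𝓡 (n + 1)) 𝓘(ℝ, ℝ) (fun x => D x j) x, ?_⟩
    simp only [A]
    rw [h5]
    exact h4.mfderiv
  have hcongr : ∀ {g g' : M → EuclideanSpace ℝ (Fin (n + 1))}
      (hg : ContMDiff (𝓡 (n + 1)) 𝓘(ℝ, EuclideanSpace ℝ (Fin (n + 1))) ∞ g)
      (hg' : ContMDiff (𝓡 (n + 1)) 𝓘(ℝ, EuclideanSpace ℝ (Fin (n + 1))) ∞ g'), g = g' →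
      pullback hg (n + 1) W = pullback hg' (n + 1) W := by
    intro g g' hg hg' h
    subst h
    rfl
  let b : Fin (n + 1) → SmoothForm (EuclideanSpace ℝ (Fin (n + 1))) M n := fun j =>
    pullback (hq (j.val + 1)) n (η j) - pullback (hq j.val) n (η j)
  -- The `j`-th move does nothing where the segment it sweeps out has `f`-integral zero.
  have hb : ∀ j x,
      (∫ s in (0 : ℝ)..(D x j), f (q j.val x + s • EuclideanSpace.single j (1 : ℝ))) = 0 →
      (b j).1 x = 0 := by
    intro j x h0
    change ((η j).1 (q (j.val + 1) x)).compContinuousLinearMap (A (q (j.val + 1)) x) -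
      ((η j).1 (q j.val x)).compContinuousLinearMap (A (q j.val) x) = 0
    rw [sub_eq_zero, hqs j x]
    obtain ⟨φ, hφ⟩ := hmf j x
    exact hη2 j (q j.val x) (D x j) _ _ φ h0 hφ
  refine ⟨∑ j, b j, ?_, ?_, ?_⟩
  · have h1 : ∀ j : Fin (n + 1), extD _ M n (b j) =
        pullback (hq (j.val + 1)) (n + 1) W - pullback (hq j.val) (n + 1) W := by
      intro j
      simp only [b]
      rw [map_sub, extD_pullback, extD_pullback, hη1]
    rw [map_sum, Finset.sum_congr rfl fun j _ => h1 j,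
      Fin.sum_univ_eq_sum_range
        (fun m => pullback (hq (m + 1)) (n + 1) W - pullback (hq m) (n + 1) W),
      Finset.sum_range_sub (fun m => pullback (hq m) (n + 1) W),
      hcongr (hq (n + 1)) (hp.add hD) hqn, hcongr (hq 0) hp hq0]
  · rw [map_sum]
    refine Finset.sum_eq_zero fun j _ => Subtype.ext (funext fun z => ?_)
    change ((b j).1 (i z)).compContinuousLinearMap (mfderiv 𝓘(ℝ, E') (𝓡 (n + 1)) i z) = 0
    by_cases hj : j = 0
    · rw [hb j (i z) (by simp [hj, hDi z])]
      rfl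
    · -- Along the submanifold the `0`-th coordinate of the intermediate maps is constant.
      have h1 : ∀ m (v : TangentSpace 𝓘(ℝ, E') z),
          A (q m) (i z) (mfderiv 𝓘(ℝ, E') (𝓡 (n + 1)) i z v) 0 = 0 := by
        intro m v
        have h2 := ((hq m).mdifferentiable (by simp) (i z)).hasMFDerivAt.comp z
          (hi.mdifferentiable (by simp) z).hasMFDerivAt
        have h3 := ((EuclideanSpace.proj (𝕜 := ℝ) (0 : Fin (n + 1))).hasFDerivAt
          (x := (q m ∘ i) z)).hasMFDerivAt.comp z h2
        have h4 : (EuclideanSpace.proj (𝕜 := ℝ) (0 : Fin (n + 1))) ∘ q m ∘ i =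
            fun _ : N => (0 : ℝ) := by
          funext w
          exact hqi m w
        rw [h4] at h3
        have h5 := hasMFDerivAt_unique h3 (hasMFDerivAt_const (0 : ℝ) z)
        exact DFunLike.congr_fun h5 v
      ext v
      refine (congrArg₂ (· - ·) (hη3 j (q (j.val + 1) (i z)) 0 _ hj fun l => h1 (j.val + 1) (v l))
        (hη3 j (q j.val (i z)) 0 _ hj fun l => h1 j.val (v l))).trans (sub_zero 0)
  · intro x hx
    rw [SmoothForm.sum_apply]
    refine Finset.sum_eq_zero fun j _ => hb j x ?_
    rcases hx with hx | hx
    · simp [hx]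
    · rw [intervalIntegral.integral_congr (g := fun _ => (0 : ℝ)) fun s hs => ?_]
      · simp
      · refine hx _ ?_
        have h2 : q j.val x + s • EuclideanSpace.single j (1 : ℝ) - p x =
            firstCoords j.val (D x) + s • EuclideanSpace.single j (1 : ℝ) := by
          simp only [q]; abel
        rw [h2]
        exact norm_firstCoords_add_le j (D x) hs

end Moves

/-! ### Nearby maps into a chart -/

section Step

/-- If `α` is the pullback of `W` by the chart `e`, then `g^*α` is the pullback of `W` by any map
that agrees with `e ∘ g` near the point in question. -/
theorem pull_chart_comp {n : ℕ} {M : Type*} [TopologicalSpace M]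
    [ChartedSpace (EuclideanSpace ℝ (Fin (n + 1))) M]
    {e : OpenPartialHomeomorph M (EuclideanSpace ℝ (Fin (n + 1)))}
    (he : ContMDiffOn (𝓡 (n + 1)) 𝓘(ℝ, EuclideanSpace ℝ (Fin (n + 1))) ∞ e e.source)
    {W : FormField (EuclideanSpace ℝ (Fin (n + 1))) (EuclideanSpace ℝ (Fin (n + 1))) (n + 1)}
    {α : FormField (EuclideanSpace ℝ (Fin (n + 1))) M (n + 1)}
    (hα : ∀ x ∈ e.source, α x = FormField.pull (M := M) e W x) {g : M → M}
    (hg : ContMDiff (𝓡 (n + 1)) (𝓡 (n + 1)) ∞ g) {G : M → EuclideanSpace ℝ (Fin (n + 1))} {x : M}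
    (hx : g x ∈ e.source) (hG : G =ᶠ[𝓝 x] e ∘ g) :
    FormField.pull (E := EuclideanSpace ℝ (Fin (n + 1))) G W x =
      FormField.pull (E := EuclideanSpace ℝ (Fin (n + 1))) g α x := by
  have h1 : MDifferentiableAt (𝓡 (n + 1)) 𝓘(ℝ, EuclideanSpace ℝ (Fin (n + 1))) e (g x) :=
    (he.contMDiffAt (e.open_source.mem_nhds hx)).mdifferentiableAt (by simp)
  rw [FormField.pull_congr W hG,
    ← FormField.pull_pull W h1 (hg.mdifferentiable (by simp) x)]
  unfold FormField.pull
  rw [hα _ hx]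
  rfl

variable {n : ℕ} {M : Type*} [TopologicalSpace M] [T2Space M]
    [SecondCountableTopology M] [ChartedSpace (EuclideanSpace ℝ (Fin (n + 1))) M]
  [IsManifold (𝓡 (n + 1)) ∞ M]

/-- A smooth cutoff function that is `1` near a closed set `C` and supported in an open set `W`. -/
theorem exists_cutoff {C W : Set M} (hC : IsClosed C) (hW : IsOpen W) (h : C ⊆ W) :
    ∃ χ : M → ℝ, ContMDiff (𝓡 (n + 1)) 𝓘(ℝ, ℝ) ∞ χ ∧ (∀ᶠ x in 𝓝ˢ C, χ x = 1) ∧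
      tsupport χ ⊆ W ∧ ∀ x, χ x ∈ Icc (0 : ℝ) 1 := by
  have : LocallyCompactSpace M :=
    ChartedSpace.locallyCompactSpace (EuclideanSpace ℝ (Fin (n + 1))) M
  obtain ⟨u, hu, hCu, huW⟩ := normal_exists_closure_subset hC hW h
  obtain ⟨χ, h1, h2, h3⟩ := exists_contMDiffMap_one_nhds_of_subset_interior (𝓡 (n + 1))
    (n := ⊤) hC (hCu.trans (interior_maximal subset_closure hu))
  refine ⟨χ, χ.contMDiff, h1, (closure_minimal (fun x hx => ?_) isClosed_closure).trans huW, h3⟩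
  by_contra hx'
  exact hx (h2 x hx')

variable {E' : Type*} [NormedAddCommGroup E'] [NormedSpace ℝ E']
  {N : Type*} [TopologicalSpace N] [ChartedSpace E' N] [IsManifold 𝓘(ℝ, E') ∞ N]

/-- Two maps that are close to each other over a chart pull back a form supported in the chart to
forms that differ by the derivative of a relative form. Here the form is `f · vol` in the chart, `L`
is a neighbourhood of its support, and the coordinates of `g` are replaced by those of `g'` where
`g` takes values in `L`. -/
theorem exists_primitive_of_close {e : OpenPartialHomeomorph M (EuclideanSpace ℝ (Fin (n + 1)))}
    (he : ContMDiffOn (𝓡 (n + 1)) 𝓘(ℝ, EuclideanSpace ℝ (Fin (n + 1))) ∞ e e.source)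
    {f : EuclideanSpace ℝ (Fin (n + 1)) → ℝ} (hf : ContDiff ℝ ∞ f) (hc : HasCompactSupport f)
    {α : SmoothForm (EuclideanSpace ℝ (Fin (n + 1))) M (n + 1)}
    (hα : ∀ x ∈ e.source, α.1 x =
      FormField.pull (M := M) e (SmoothForm.ofContDiff _ (contDiff_smul_stdVol hf)).1 x)
    (hα0 : ∀ x ∉ e.source, α.1 x = 0)
    {i : N → M} (hi : ContMDiff 𝓘(ℝ, E') (𝓡 (n + 1)) ∞ i)
    (hei : ∀ z, i z ∈ e.source → e (i z) 0 = 0) {δ : ℝ} (hδ : 0 ≤ δ) {L : Set M}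
    (hL : IsClosed L)
    (hLe : L = e.source ∩ e ⁻¹' Metric.cthickening δ (tsupport f))
    {g g' : M → M} (hg : ContMDiff (𝓡 (n + 1)) (𝓡 (n + 1)) ∞ g)
    (hg' : ContMDiff (𝓡 (n + 1)) (𝓡 (n + 1)) ∞ g')
    (hgi : ∀ z, g (i z) ∈ range i) (hgi' : ∀ z, g' (i z) ∈ range i)
    (h1 : ∀ x, g x ∈ L → g' x ∈ e.source ∧ dist (e (g' x)) (e (g x)) < δ)
    (h2 : ∀ x, g' x ∈ L → g x ∈ e.source ∧ dist (e (g x)) (e (g' x)) < δ) :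
    ∃ β : SmoothForm (EuclideanSpace ℝ (Fin (n + 1))) M n,
      extD _ M n β = pullback hg' (n + 1) α - pullback hg (n + 1) α ∧
      pullback hi n β = 0 ∧ ∀ x, g x ∉ L → β.1 x = 0 := by
  have hmemL : ∀ x ∈ e.source, ∀ y, f y ≠ 0 → dist (e x) y ≤ δ → x ∈ L := by
    intro x hx y hy hd
    rw [hLe]
    exact ⟨hx, Metric.mem_cthickening_of_dist_le _ y _ _ (subset_tsupport f hy) hd⟩
  have hLs : ∀ x ∈ L, x ∈ e.source := fun x hx => by
    rw [hLe] at hx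
    exact hx.1
  let V : Set M := g ⁻¹' e.source ∩ g' ⁻¹' e.source
  have hV : IsOpen V :=
    (e.open_source.preimage hg.continuous).inter (e.open_source.preimage hg'.continuous)
  have hcg : ContinuousOn (e ∘ g) V :=
    e.continuousOn.comp hg.continuous.continuousOn fun x hx => hx.1
  have hcg' : ContinuousOn (e ∘ g') V :=
    e.continuousOn.comp hg'.continuous.continuousOn fun x hx => hx.2
  let U : Set M := V ∩ {x | dist ((e ∘ g') x) ((e ∘ g) x) < δ}
  have hU : IsOpen U :=
    (continuous_dist.comp_continuousOn (ContinuousOn.prodMk hcg' hcg)).isOpen_inter_preimage hV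
      isOpen_Iio
  have hCU : g ⁻¹' L ⊆ U := fun x hx => ⟨⟨hLs _ hx, (h1 x hx).1⟩, (h1 x hx).2⟩
  have hC : IsClosed (g ⁻¹' L) := hL.preimage hg.continuous
  obtain ⟨χ, hχ, hχ1, hχU, hχI⟩ := exists_cutoff (n := n) hC hU hCU
  obtain ⟨χ', hχ', hχ1', hχU', hχI'⟩ := exists_cutoff (n := n) (isClosed_tsupport χ) hU hχU
  have hχone : ∀ x ∈ tsupport χ, χ' x = 1 := fun x hx => hχ1'.self_of_nhdsSet x hx
  have hsm : ∀ x ∈ U, ContMDiffAt (𝓡 (n + 1)) 𝓘(ℝ, EuclideanSpace ℝ (Fin (n + 1))) ∞ (e ∘ g) x :=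
    fun x hx => (he.contMDiffAt (e.open_source.mem_nhds hx.1.1)).comp x hg.contMDiffAt
  have hsm' : ∀ x ∈ U,
      ContMDiffAt (𝓡 (n + 1)) 𝓘(ℝ, EuclideanSpace ℝ (Fin (n + 1))) ∞ (e ∘ g') x :=
    fun x hx => (he.contMDiffAt (e.open_source.mem_nhds hx.1.2)).comp x hg'.contMDiffAt
  -- Cutoffs make the coordinate expressions of `g` and of `g' - g` into globally smooth maps. As
  -- `χ' = 1` on the support of `χ`, the artificial values of `p` never move.
  let p : M → EuclideanSpace ℝ (Fin (n + 1)) := fun x => χ' x • (e ∘ g) x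
  let D : M → EuclideanSpace ℝ (Fin (n + 1)) := fun x => χ x • ((e ∘ g') x - (e ∘ g) x)
  have hp : ContMDiff (𝓡 (n + 1)) 𝓘(ℝ, EuclideanSpace ℝ (Fin (n + 1))) ∞ p :=
    contMDiff_of_tsupport fun x hx => hχ'.contMDiffAt.smul
      (hsm x (hχU' (tsupport_smul_subset_left χ' _ hx)))
  have hD : ContMDiff (𝓡 (n + 1)) 𝓘(ℝ, EuclideanSpace ℝ (Fin (n + 1))) ∞ D :=
    contMDiff_of_tsupport fun x hx => by
      have hx' := hχU (tsupport_smul_subset_left χ _ hx)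
      exact hχ.contMDiffAt.smul ((hsm' x hx').sub (hsm x hx'))
  have hgz : ∀ z, i z ∈ U → e (g (i z)) 0 = 0 := by
    intro z hz
    obtain ⟨w, hw⟩ := hgi z
    rw [← hw]
    exact hei w (hw ▸ hz.1.1)
  have hgz' : ∀ z, i z ∈ U → e (g' (i z)) 0 = 0 := by
    intro z hz
    obtain ⟨w, hw⟩ := hgi' z
    rw [← hw]
    exact hei w (hw ▸ hz.1.2)
  have hpi : ∀ z, p (i z) 0 = 0 := by
    intro z
    by_cases hz : χ' (i z) = 0
    · simp [p, hz]
    · simp [p, hgz z (hχU' (subset_tsupport χ' hz))]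
  have hDi : ∀ z, D (i z) 0 = 0 := by
    intro z
    by_cases hz : χ (i z) = 0
    · simp [D, hz]
    · have := hχU (subset_tsupport χ hz)
      simp [D, hgz z this, hgz' z this]
  obtain ⟨β, hβ1, hβ2, hβ3⟩ := exists_primitive_pullback_sub hf hc hp hD hi hpi hDi
  have hβ0 : ∀ x, g x ∉ L → β.1 x = 0 := by
    intro x hx
    refine hβ3 x ?_
    -- A point of the support of `f` within `δ` of `e (g x)` would force `g x ∈ L`.
    by_cases hχx : χ x = 0
    · left; simp [D, hχx]
    · right
      intro y hy
      by_contra hfy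
      have hxt := subset_tsupport χ hχx
      have hxU := hχU hxt
      have hpx : p x = e (g x) := by simp [p, hχone x hxt]
      refine hx (hmemL _ hxU.1.1 y hfy ?_)
      rw [dist_comm, dist_eq_norm, ← hpx]
      refine hy.trans ?_
      rw [norm_smul, Real.norm_eq_abs, abs_of_nonneg (hχI x).1]
      refine (mul_le_of_le_one_left (norm_nonneg _) (hχI x).2).trans ?_
      rw [← dist_eq_norm]
      exact hxU.2.le
  refine ⟨β, ?_, hβ2, hβ0⟩
  refine Subtype.ext (funext fun x => ?_)
  change β.1.d x = FormField.pull g' α.1 x - FormField.pull g α.1 x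
  by_cases hx : g x ∈ L
  · have hxt : x ∈ tsupport χ := subset_tsupport χ (by
      rw [Function.mem_support, hχ1.self_of_nhdsSet x hx]; exact one_ne_zero)
    have e1 : ∀ᶠ y in 𝓝 x, χ y = 1 := hχ1.filter_mono (nhds_le_nhdsSet (s := g ⁻¹' L) hx)
    have e2 : ∀ᶠ y in 𝓝 x, χ' y = 1 := hχ1'.filter_mono (nhds_le_nhdsSet hxt)
    have h3 := congrFun (congrArg Subtype.val hβ1) x
    refine h3.trans ?_
    refine congrArg₂ (· - ·) (pull_chart_comp he hα hg' (hCU hx).1.2 ?_)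
      (pull_chart_comp he hα hg (hCU hx).1.1 ?_)
    · filter_upwards [e1, e2] with y hy hy'
      simp [p, D, hy, hy']
    · filter_upwards [e2] with y hy'
      simp [p, hy']
  · have h3 : β.1.d x = 0 := by
      have : β.1.d x = (0 : FormField (EuclideanSpace ℝ (Fin (n + 1))) M n).d x := by
        refine FormField.d_congr ?_
        filter_upwards [hC.isOpen_compl.mem_nhds hx] with y hy
        exact hβ0 y hy
      rw [this]
      exact congrFun (congrArg Subtype.val
        (map_zero (extD (EuclideanSpace ℝ (Fin (n + 1))) M n))) x
    have h4 : ∀ y, y ∉ L → α.1 y = 0 := by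
      intro y hy
      by_cases hys : y ∈ e.source
      · have hfy : f (e y) = 0 := by
          by_contra hfy
          exact hy (hmemL y hys _ hfy (by simpa using hδ))
        rw [hα y hys]
        ext v
        change f (e y) • _ = (0 : ℝ)
        rw [hfy, zero_smul]
      · exact hα0 y hys
    have h5 : α.1 (g' x) = 0 := by
      by_contra hne
      have hgL : g' x ∈ L := by
        by_contra h
        exact hne (h4 _ h)
      obtain ⟨hgs, hgd⟩ := h2 x hgL
      have hfy : f (e (g' x)) ≠ 0 := by
        intro hfy
        refine hne ?_
        rw [hα _ (hLs _ hgL)]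
        ext v
        change f (e (g' x)) • _ = (0 : ℝ)
        rw [hfy, zero_smul]
      exact hx (hmemL _ hgs _ hfy hgd.le)
    rw [h3]
    unfold FormField.pull
    rw [h5, h4 _ hx]
    ext v
    change (0 : ℝ) = 0 - 0
    simp

end Step

/-! ### Isotopies and forms supported in a chart -/

section Topological

/-- A continuous family of homeomorphisms of a locally compact, locally connected space has a
continuous family of inverses. A connected neighbourhood of the image of `x` that avoids the image
of the boundary of a neighbourhood `U` of `x` has its preimage inside `U`. -/
theorem continuous_symm_of_continuous {T X : Type*} [TopologicalSpace T] [TopologicalSpace X]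
    [T2Space X] [LocallyCompactSpace X] [LocallyConnectedSpace X] {h : T → X ≃ₜ X}
    (hh : Continuous fun p : T × X => h p.1 p.2) :
    Continuous fun p : T × X => (h p.1).symm p.2 := by
  rw [continuous_iff_continuousAt]
  rintro ⟨t₀, y₀⟩
  set x₀ := (h t₀).symm y₀ with hx₀
  have hy₀ : h t₀ x₀ = y₀ := (h t₀).apply_symm_apply y₀
  intro O hO
  obtain ⟨O', hO'O, hO', hxO'⟩ := mem_nhds_iff.1 hO
  obtain ⟨K, hK, hxK, hKO⟩ := exists_compact_subset hO' hxO'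
  set U := interior K with hU
  have hUK : closure U ⊆ K := closure_minimal interior_subset hK.isClosed
  have hF : IsCompact (frontier U) :=
    hK.of_isClosed_subset isClosed_frontier (frontier_subset_closure.trans hUK)
  have hyF : y₀ ∉ h t₀ '' frontier U := by
    rintro ⟨x, hx, hxy⟩
    rw [← hy₀] at hxy
    rw [(h t₀).injective hxy, isOpen_interior.frontier_eq] at hx
    exact hx.2 hxK
  obtain ⟨A, ⟨hA, hAc⟩, hAF⟩ := (closed_nhds_basis y₀).mem_iff.1
    ((hF.image (h t₀).continuous).isClosed.isOpen_compl.mem_nhds hyF)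
  obtain ⟨V, hVA, hV, hyV, hVc⟩ :=
    locallyConnectedSpace_iff_subsets_isOpen_isConnected.1 inferInstance y₀ A hA
  have h1 : ∀ᶠ t in 𝓝 t₀, ∀ x ∈ frontier U, h t x ∉ A := by
    refine hF.eventually_forall_of_forall_eventually fun x hx => ?_
    refine hh.continuousAt.eventually (hAc.isOpen_compl.mem_nhds fun hxA => ?_)
    exact hAF hxA ⟨x, hx, rfl⟩
  have h2 : ∀ᶠ t in 𝓝 t₀, h t x₀ ∈ V := by
    have : Continuous fun t => h t x₀ := hh.comp (.prodMk_left x₀)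
    exact this.continuousAt.eventually (hV.mem_nhds (by simpa [hy₀] using hyV))
  rw [mem_map, nhds_prod_eq]
  filter_upwards [(h1.and h2).prod_mk (hV.mem_nhds hyV)] with p hp
  refine hO'O (hKO (interior_subset ?_))
  have hS : IsPreconnected ((h p.1).symm '' V) :=
    hVc.isPreconnected.image _ (h p.1).symm.continuous.continuousOn
  by_contra hpU
  have hSF : ∀ x ∈ (h p.1).symm '' V, x ∉ U → x ∈ (closure U)ᶜ := by
    rintro _ ⟨y, hy, rfl⟩ hxU hxc
    refine hp.1.1 ((h p.1).symm y) ?_ (hVA (by simpa using hy))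
    rw [isOpen_interior.frontier_eq]
    exact ⟨hxc, hxU⟩
  obtain ⟨x, -, hxU, hxc⟩ := hS U (closure U)ᶜ isOpen_interior isClosed_closure.isOpen_compl
    (fun x hx => or_iff_not_imp_left.2 (hSF x hx))
    ⟨x₀, ⟨_, hp.1.2, (h p.1).symm_apply_apply x₀⟩, hxK⟩
    ⟨_, ⟨p.2, hp.2, rfl⟩, hSF _ ⟨p.2, hp.2, rfl⟩ hpU⟩
  exact hxc (subset_closure hxU)

/-- Over a compact subset `L` of a chart domain, the maps of a continuous family parametrised by a
compact space are uniformly close to each other in the chart for nearby parameters. -/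
theorem exists_uniform_step {T X Y : Type*} [MetricSpace T] [CompactSpace T] [TopologicalSpace X]
    [T2Space X] [LocallyCompactSpace X] [LocallyConnectedSpace X] [MetricSpace Y] {h : T → X ≃ₜ X}
    (hh : Continuous fun p : T × X => h p.1 p.2) (e : OpenPartialHomeomorph X Y) {L : Set X}
    (hL : IsCompact L) (hLe : L ⊆ e.source) {δ : ℝ} (hδ : 0 < δ) :
    ∃ τ > 0, ∀ t s, dist t s < τ → ∀ x, h t x ∈ L →
      h s x ∈ e.source ∧ dist (e (h s x)) (e (h t x)) < δ := by
  have hinv := continuous_symm_of_continuous hh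
  -- In terms of `y = h t x` the parameters `(t, s, y)` range over a compact set.
  let Φ : T × T × X → X := fun p => h p.2.1 ((h p.1).symm p.2.2)
  have hΦ : Continuous Φ := hh.comp (continuous_snd.fst.prodMk
    (hinv.comp (continuous_fst.prodMk continuous_snd.snd)))
  let V : Set (T × T × X) := {p | p.2.2 ∈ e.source} ∩ Φ ⁻¹' e.source
  have hV : IsOpen V :=
    (e.open_source.preimage continuous_snd.snd).inter (e.open_source.preimage hΦ)
  let O : Set (T × T × X) := V ∩ {p | dist (e (Φ p)) (e p.2.2) < δ}
  have hO : IsOpen O := by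
    refine ContinuousOn.isOpen_inter_preimage (f := fun p => dist (e (Φ p)) (e p.2.2)) ?_ hV
      isOpen_Iio
    exact continuous_dist.comp_continuousOn (ContinuousOn.prodMk
      (e.continuousOn.comp hΦ.continuousOn fun p hp => hp.2)
      (e.continuousOn.comp continuous_snd.snd.continuousOn fun p hp => hp.1))
  have hK : IsCompact (((univ : Set T) ×ˢ (univ : Set T) ×ˢ L) \ O) :=
    (isCompact_univ.prod (isCompact_univ.prod hL)).diff hO
  obtain ⟨τ, hτ, hτK⟩ : ∃ τ > 0, ∀ p ∈ ((univ : Set T) ×ˢ (univ : Set T) ×ˢ L) \ O,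
      τ ≤ dist p.1 p.2.1 := by
    rcases (((univ : Set T) ×ˢ (univ : Set T) ×ˢ L) \ O).eq_empty_or_nonempty with hem | hne
    · exact ⟨1, one_pos, by simp [hem]⟩
    · obtain ⟨p, hp, hpm⟩ := hK.exists_isMinOn hne
        (continuous_fst.dist continuous_snd.fst).continuousOn
      refine ⟨dist p.1 p.2.1, dist_pos.2 fun hpe => hp.2 ?_, fun q hq => hpm hq⟩
      have hpL : p.2.2 ∈ e.source := hLe hp.1.2.2
      have hpΦ : Φ p = p.2.2 := by simp [Φ, ← hpe]
      exact ⟨⟨hpL, by simpa [hpΦ] using hpL⟩, by simpa [hpΦ] using hδ⟩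
  refine ⟨τ, hτ, fun t s hts x hx => ?_⟩
  have hmem : ((t, s, h t x) : T × T × X) ∈ O := by
    by_contra hn
    exact (hτK (t, s, h t x) ⟨⟨mem_univ _, mem_univ _, hx⟩, hn⟩).not_gt hts
  have hΦx : Φ (t, s, h t x) = h s x := by simp [Φ]
  refine ⟨?_, ?_⟩
  · simpa [hΦx] using hmem.1.2
  · simpa [hΦx] using hmem.2

end Topological

section Isotopy

variable {n : ℕ} {M : Type*} [TopologicalSpace M] [T2Space M]
    [SecondCountableTopology M] [ChartedSpace (EuclideanSpace ℝ (Fin (n + 1))) M]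
  [IsManifold (𝓡 (n + 1)) ∞ M]
  {E' : Type*} [NormedAddCommGroup E'] [NormedSpace ℝ E']
  {N : Type*} [TopologicalSpace N] [ChartedSpace E' N] [IsManifold 𝓘(ℝ, E') ∞ N]

/-- A continuous isotopy through diffeomorphisms preserving the submanifold pulls back a form
supported in a chart to a form in the same relative class. The primitive of the difference lives
where the isotopy passes through the given neighbourhood `O` of the support. -/
theorem exists_primitive_of_isotopy
    {γ : unitInterval → M ≃ₘ⟮𝓡 (n + 1), 𝓡 (n + 1)⟯ M}
    (hγ : Continuous fun p : unitInterval × M => γ p.1 p.2)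
    {e : OpenPartialHomeomorph M (EuclideanSpace ℝ (Fin (n + 1)))}
    (he : ContMDiffOn (𝓡 (n + 1)) 𝓘(ℝ, EuclideanSpace ℝ (Fin (n + 1))) ∞ e e.source)
    {f : EuclideanSpace ℝ (Fin (n + 1)) → ℝ} (hf : ContDiff ℝ ∞ f) (hc : HasCompactSupport f)
    {α : SmoothForm (EuclideanSpace ℝ (Fin (n + 1))) M (n + 1)}
    (hα : ∀ x ∈ e.source, α.1 x =
      FormField.pull (M := M) e (SmoothForm.ofContDiff _ (contDiff_smul_stdVol hf)).1 x)
    (hα0 : ∀ x ∉ e.source, α.1 x = 0)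
    {i : N → M} (hi : ContMDiff 𝓘(ℝ, E') (𝓡 (n + 1)) ∞ i)
    (hei : ∀ z, i z ∈ e.source → e (i z) 0 = 0) (hγi : ∀ t z, γ t (i z) ∈ range i)
    {O : Set M} (hO : IsOpen O) (hOe : O ⊆ e.source) (hfO : tsupport f ⊆ e '' O) :
    ∃ β : SmoothForm (EuclideanSpace ℝ (Fin (n + 1))) M n,
      extD _ M n β = pullback (γ 1).contMDiff (n + 1) α - pullback (γ 0).contMDiff (n + 1) α ∧
      pullback hi n β = 0 ∧ ∀ x, (∀ t, γ t x ∉ O) → β.1 x = 0 := by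
  have : LocallyCompactSpace M :=
    ChartedSpace.locallyCompactSpace (EuclideanSpace ℝ (Fin (n + 1))) M
  have : LocallyConnectedSpace M :=
    ChartedSpace.locallyConnectedSpace (EuclideanSpace ℝ (Fin (n + 1))) M
  obtain ⟨δ, hδ, hδO⟩ := hc.isCompact.exists_cthickening_subset_open
    (e.isOpen_image_of_subset_source hO hOe) hfO
  have hkt : Metric.cthickening δ (tsupport f) ⊆ e.target := by
    refine hδO.trans ?_
    rintro _ ⟨x, hx, rfl⟩
    exact e.map_source (hOe hx)
  set L : Set M := e.source ∩ e ⁻¹' Metric.cthickening δ (tsupport f) with hLdef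
  have hLimg : L = e.symm '' Metric.cthickening δ (tsupport f) := by
    rw [hLdef, e.symm_image_eq_source_inter_preimage hkt]
  have hL : IsCompact L := by
    rw [hLimg]
    exact hc.isCompact.cthickening.image_of_continuousOn (e.continuousOn_symm.mono hkt)
  have hLO : L ⊆ O := by
    rintro x ⟨hx, hxk⟩
    obtain ⟨y, hy, hyx⟩ := hδO hxk
    rwa [← e.injOn (hOe hy) hx hyx]
  obtain ⟨τ, hτ, hstep⟩ := exists_uniform_step (h := fun t => (γ t).toHomeomorph) hγ e hL
    (fun x hx => hx.1) hδ
  obtain ⟨m, hm⟩ := exists_nat_one_div_lt hτ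
  -- Steps of length `1 / (m + 1)`; the projection is the identity for `k ≤ m + 1`.
  let t : ℕ → unitInterval := fun k => projIcc 0 1 zero_le_one ((k : ℝ) / (m + 1))
  have ht0 : t 0 = 0 := by simp [t]
  have htm : t (m + 1) = 1 := by
    have : ((m + 1 : ℕ) : ℝ) / (m + 1) = 1 := by
      push_cast
      exact div_self (by positivity)
    simp only [t, this]
    exact projIcc_right _
  have htd : ∀ k, dist (t k) (t (k + 1)) < τ := by
    intro k
    refine lt_of_le_of_lt ((LipschitzWith.projIcc zero_le_one).dist_le_mul _ _) ?_
    have : ((k : ℝ) / (m + 1)) - (((k + 1 : ℕ) : ℝ) / (m + 1)) = -(1 / (m + 1)) := by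
      push_cast
      ring
    rw [Real.dist_eq, this, abs_neg, abs_of_pos (by positivity)]
    simpa using hm
  choose β hβ1 hβ2 hβ3 using fun k => exists_primitive_of_close he hf hc hα hα0 hi hei hδ.le
    hL.isClosed hLdef (γ (t k)).contMDiff (γ (t (k + 1))).contMDiff (hγi _) (hγi _)
    (fun x hx => hstep _ _ (htd k) x hx)
    (fun x hx => hstep _ _ ((dist_comm _ _).trans_lt (htd k)) x hx)
  refine ⟨∑ k ∈ Finset.range (m + 1), β k, ?_, ?_, ?_⟩
  · rw [map_sum, Finset.sum_congr rfl fun k _ => hβ1 k,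
      Finset.sum_range_sub (fun k => pullback (γ (t k)).contMDiff (n + 1) α), ht0, htm]
  · rw [map_sum]
    exact Finset.sum_eq_zero fun k _ => hβ2 k
  · intro x hx
    rw [SmoothForm.sum_apply]
    refine Finset.sum_eq_zero fun k _ => hβ3 k x fun hxL => ?_
    exact hx _ (hLO hxL)

end Isotopy

/-! ### Coordinate functions of top-degree forms and slice charts -/

section Charts

variable {E : Type*} [NormedAddCommGroup E] [NormedSpace ℝ E]
  {M : Type*} [TopologicalSpace M] [ChartedSpace E M]

/-- Multiplication of a smooth form by a smooth function. -/
noncomputable def SmoothForm.mulFun {k : ℕ} [IsManifold 𝓘(ℝ, E) ∞ M] (ρ : M → ℝ)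
    (hρ : ContMDiff 𝓘(ℝ, E) 𝓘(ℝ, ℝ) ∞ ρ)
    (α : SmoothForm E M k) : SmoothForm E M k :=
  ⟨fun x => ρ x • α.1 x, fun x => by
    have h1 : ContDiffOn ℝ ∞ (ρ ∘ (chartAt E x).symm) (chartAt E x).target := by
      rw [← contMDiffOn_iff_contDiffOn]
      exact hρ.comp_contMDiffOn (contMDiffOn_chart_symm (I := 𝓘(ℝ, E)))
    exact h1.smul (α.2 x)⟩

/-- The coordinate expression of a smooth form is smooth in every smooth chart, not only in those
of the preferred family. -/
theorem SmoothForm.contDiffOn_rep [IsManifold 𝓘(ℝ, E) ∞ M] {k : ℕ} (α : SmoothForm E M k)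
    {e : OpenPartialHomeomorph M E}
    (he : ContMDiffOn 𝓘(ℝ, E) 𝓘(ℝ, E) ∞ e.symm e.target) :
    ContDiffOn ℝ ∞ (FormField.rep e α.1) e.target := by
  intro y hy
  set z := e.symm y with hz
  have hzs : z ∈ (chartAt E z).source := mem_chart_source E z
  have hes : ∀ w ∈ e.target, MDifferentiableAt 𝓘(ℝ, E) 𝓘(ℝ, E) e.symm w := fun w hw =>
    (he.contMDiffAt (e.open_target.mem_nhds hw)).mdifferentiableAt (by simp)
  have hτ : ContDiffAt ℝ ∞ (chartAt E z ∘ e.symm) y := by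
    rw [← contMDiffAt_iff_contDiffAt]
    exact ((contMDiffOn_chart (I := 𝓘(ℝ, E)) (n := ∞) (x := z)).contMDiffAt
      ((chartAt E z).open_source.mem_nhds hzs)).comp y (he.contMDiffAt (e.open_target.mem_nhds hy))
  have hpre : e.symm ⁻¹' (chartAt E z).source ∈ 𝓝 y :=
    (e.continuousAt_symm hy).preimage_mem_nhds ((chartAt E z).open_source.mem_nhds hzs)
  have hev : FormField.rep e α.1 =ᶠ[𝓝 y] fun w =>
      (α.1.rep (chartAt E z) ((chartAt E z ∘ e.symm) w)).compContinuousLinearMap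
        (fderiv ℝ (chartAt E z ∘ e.symm) w) := by
    filter_upwards [eventually_mem_nhds_iff.2 hpre, e.open_target.mem_nhds hy] with w hw hwt
    have hws : e.symm w ∈ (chartAt E z).source := mem_preimage.1 (mem_of_mem_nhds hw)
    have hcomp : MDifferentiableAt 𝓘(ℝ, E) 𝓘(ℝ, E) (chartAt E z ∘ e.symm) w :=
      (mdiffAt_chart z hws).comp w (hes w hwt)
    rw [← mfderiv_eq_fderiv]
    change FormField.pull e.symm α.1 w =
      FormField.pull (chartAt E z ∘ e.symm) (FormField.pull (E := E) (chartAt E z).symm α.1) w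
    rw [FormField.pull_pull (g := (chartAt E z).symm) (f := chartAt E z ∘ e.symm) (x := w) α.1
      (mdiffAt_chart_symm z ((chartAt E z).map_source hws)) hcomp]
    refine FormField.pull_congr α.1 ?_
    filter_upwards [hw] with u hu
    exact ((chartAt E z).left_inv hu).symm
  refine (ContDiffAt.congr_of_eventuallyEq ?_ hev).contDiffWithinAt
  have h1 : ContDiffAt ℝ ∞ (fun w => α.1.rep (chartAt E z) ((chartAt E z ∘ e.symm) w)) y :=
    ContDiffAt.comp y (α.2.contDiffAt z ((chartAt E z).map_source hzs)) hτ
  exact ((contDiff_compContinuousLinearMap k).contDiffAt).comp y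
    (h1.prodMk (hτ.fderiv_right (by simp)))

/-- A form of top degree with compact support in a chart domain is `f · vol` in that chart. -/
theorem SmoothForm.exists_coordinate_function {n : ℕ} {M : Type*} [TopologicalSpace M] [T2Space M]
    [ChartedSpace (EuclideanSpace ℝ (Fin n)) M] [IsManifold (𝓡 n) ∞ M]
    (α : SmoothForm (EuclideanSpace ℝ (Fin n)) M n)
    {e : OpenPartialHomeomorph M (EuclideanSpace ℝ (Fin n))}
    (he : ContMDiffOn (𝓡 n) 𝓘(ℝ, EuclideanSpace ℝ (Fin n)) ∞ e e.source)
    (hes : ContMDiffOn 𝓘(ℝ, EuclideanSpace ℝ (Fin n)) (𝓡 n) ∞ e.symm e.target)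
    {K : Set M} (hK : IsCompact K) (hKe : K ⊆ e.source) (hα : ∀ x ∉ K, α.1 x = 0) :
    ∃ (f : EuclideanSpace ℝ (Fin n) → ℝ) (hf : ContDiff ℝ ∞ f), HasCompactSupport f ∧
      tsupport f ⊆ e '' K ∧ ∀ x ∈ e.source, α.1 x =
        FormField.pull (M := M) e (SmoothForm.ofContDiff _ (contDiff_smul_stdVol hf)).1 x := by
  classical
  let f₀ : EuclideanSpace ℝ (Fin n) → ℝ := fun y =>
    (FormField.rep e α.1 y : EuclideanSpace ℝ (Fin n) [⋀^Fin n]→L[ℝ] ℝ)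
      fun i => EuclideanSpace.single i 1
  have hf₀ : ContDiffOn ℝ ∞ f₀ e.target :=
    (ContinuousAlternatingMap.apply ℝ (EuclideanSpace ℝ (Fin n)) ℝ
      (fun i => EuclideanSpace.single i (1 : ℝ))).contDiff.comp_contDiffOn
      (SmoothForm.contDiffOn_rep α hes)
  let f : EuclideanSpace ℝ (Fin n) → ℝ := e.target.indicator f₀
  have hsupp : Function.support f ⊆ e '' K := by
    intro y hy
    have hyt : y ∈ e.target := mem_of_indicator_ne_zero hy
    refine ⟨e.symm y, ?_, e.right_inv hyt⟩
    by_contra hn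
    refine hy ?_
    have h0 : FormField.rep e α.1 y = 0 := by
      unfold FormField.rep FormField.pull
      rw [hα _ hn]
      rfl
    simp [f, f₀, hyt, h0]
  have heK : IsCompact (e '' K) := hK.image_of_continuousOn (e.continuousOn.mono hKe)
  have hts : tsupport f ⊆ e '' K := closure_minimal hsupp heK.isClosed
  have heKt : e '' K ⊆ e.target := by
    rintro _ ⟨x, hx, rfl⟩
    exact e.map_source (hKe hx)
  have hf : ContDiff ℝ ∞ f := by
    rw [contDiff_iff_contDiffAt]
    intro y
    by_cases hy : y ∈ e.target
    · refine (hf₀.contDiffAt (e.open_target.mem_nhds hy)).congr_of_eventuallyEq ?_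
      filter_upwards [e.open_target.mem_nhds hy] with w hw
      simp [f, hw]
    · refine contDiffAt_const (c := (0 : ℝ)) |>.congr_of_eventuallyEq ?_
      filter_upwards [heK.isClosed.isOpen_compl.mem_nhds fun h => hy (heKt h)] with w hw
      by_contra hne
      exact hw (hsupp hne)
  refine ⟨f, hf, heK.of_isClosed_subset (isClosed_tsupport f) hts, hts, fun x hx => ?_⟩
  have h1 : (SmoothForm.ofContDiff _ (contDiff_smul_stdVol hf)).1 (e x) =
      FormField.rep e α.1 (e x) := by
    have h2 : f (e x) = f₀ (e x) := by simp [f, e.map_source hx]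
    change f (e x) • stdVol n = _
    rw [h2]
    exact (eq_smul_stdVol _).symm
  rw [← FormField.pull_rep he hes α.1 hx]
  unfold FormField.pull
  rw [h1]

/-- Around every point there is a smooth chart in which a closed embedded hypersurface `Z` lies in
the hyperplane where the first coordinate vanishes. -/
theorem exists_slice_chart {n : ℕ} {M : Type*} [TopologicalSpace M]
    [ChartedSpace (EuclideanSpace ℝ (Fin (n + 1))) M] [IsManifold (𝓡 (n + 1)) ∞ M]
    {Z : Set M} [ChartedSpace (EuclideanSpace ℝ (Fin n)) Z] [IsManifold (𝓡 n) ∞ Z]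
    (hZ : Manifold.IsSmoothEmbedding (𝓡 n) (𝓡 (n + 1)) ∞ (Subtype.val : Z → M))
    (hZc : IsClosed Z) (p : M) :
    ∃ e : OpenPartialHomeomorph M (EuclideanSpace ℝ (Fin (n + 1))), p ∈ e.source ∧
      ContMDiffOn (𝓡 (n + 1)) 𝓘(ℝ, EuclideanSpace ℝ (Fin (n + 1))) ∞ e e.source ∧
      ContMDiffOn 𝓘(ℝ, EuclideanSpace ℝ (Fin (n + 1))) (𝓡 (n + 1)) ∞ e.symm e.target ∧
      ∀ z : Z, (z : M) ∈ e.source → e z 0 = 0 := by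
  by_cases hp : p ∈ Z
  · have h := hZ.isImmersion.isImmersionAt ⟨p, hp⟩
    obtain ⟨O, hO, hOd⟩ := isOpen_induced_iff.1 h.domChart.open_source
    have hfin : FiniteDimensional ℝ h.complement := by
      refine FiniteDimensional.of_injective
        (h.equiv.toLinearMap ∘ₗ LinearMap.inr ℝ (EuclideanSpace ℝ (Fin n)) h.complement) ?_
      exact h.equiv.injective.comp LinearMap.inr_injective
    have hrank : Module.finrank ℝ h.complement = Module.finrank ℝ ℝ := by
      have h1 := h.equiv.toLinearEquiv.finrank_eq
      rw [Module.finrank_prod] at h1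
      simp at h1
      simp
      omega
    -- The complement of the tangent space is a line; `Λ` makes its coordinate the first one.
    let Λ : EuclideanSpace ℝ (Fin (n + 1)) ≃L[ℝ] EuclideanSpace ℝ (Fin (n + 1)) :=
      h.equiv.symm.trans <| (ContinuousLinearEquiv.prodComm ℝ _ _).trans <|
        ((ContinuousLinearEquiv.ofFinrankEq hrank).prodCongr
          (EuclideanSpace.equiv (Fin n) ℝ)).trans <|
        (Fin.consEquivL ℝ fun _ : Fin (n + 1) => ℝ).trans
          (EuclideanSpace.equiv (Fin (n + 1)) ℝ).symm
    have hΛ : ∀ u, Λ (h.equiv (u, 0)) 0 = 0 := by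
      intro u
      simp [Λ]
    let e := (h.codChart.restrOpen O hO).transHomeomorph Λ.toHomeomorph
    have hcs := contMDiffOn_of_mem_maximalAtlas h.codChart_mem_maximalAtlas
    have hcs' := contMDiffOn_symm_of_mem_maximalAtlas h.codChart_mem_maximalAtlas
    refine ⟨e, ?_, ?_, ?_, ?_⟩
    · refine ⟨h.mem_codChart_source, ?_⟩
      have := h.mem_domChart_source
      rw [← hOd] at this
      exact this
    · exact Λ.contDiff.contMDiff.comp_contMDiffOn (hcs.mono inter_subset_left)
    · exact hcs'.comp (s := e.target) (f := Λ.symm) Λ.symm.contDiff.contMDiff.contMDiffOn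
        fun y hy => hy.1
    · intro z hz
      have hzd : z ∈ h.domChart.source := by
        rw [← hOd]
        exact hz.2
      have hzt : h.domChart z ∈ (h.domChart.extend (𝓡 n)).target := by
        rw [OpenPartialHomeomorph.extend_target]
        exact ⟨h.domChart.map_source hzd, by simp⟩
      have h1 := h.writtenInCharts hzt
      have h2 : h.codChart z = h.equiv (h.domChart z, 0) := by
        simpa [h.domChart.left_inv hzd] using h1
      change Λ (h.codChart z) 0 = 0
      rw [h2, hΛ]
  · let c := chartAt (EuclideanSpace ℝ (Fin (n + 1))) p
    refine ⟨c.restrOpen Zᶜ hZc.isOpen_compl, ⟨mem_chart_source _ p, hp⟩, ?_, ?_, ?_⟩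
    · exact (contMDiffOn_chart (I := 𝓡 (n + 1))).mono inter_subset_left
    · exact (contMDiffOn_chart_symm (I := 𝓡 (n + 1))).mono inter_subset_left
    · intro z hz
      exact absurd z.2 hz.2

end Charts

/-! ### Isotopies of the pair and forms of top degree -/

section Paths

/-- A path that is continuous for the `C^∞` topology is jointly continuous. -/
theorem continuous_eval_of_continuous_smoothTopology {E : Type*} [NormedAddCommGroup E]
    [NormedSpace ℝ E] {M : Type*} [TopologicalSpace M] [ChartedSpace E M] [LocallyCompactSpace M]
    [IsManifold 𝓘(ℝ, E) ∞ M] {T : Type*} [TopologicalSpace T]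
    {γ : T → M ≃ₘ⟮𝓘(ℝ, E), 𝓘(ℝ, E)⟯ M} (hγ : @Continuous T _ _ (smoothTopology E M) γ) :
    Continuous fun p : T × M => γ p.1 p.2 := by
  rw [continuous_iff_continuousAt]
  rintro ⟨t₀, x₀⟩
  set e := chartAt E x₀ with he
  set e' := chartAt E (γ t₀ x₀) with he'
  have hs : e.source ∩ γ t₀ ⁻¹' e'.source ∈ 𝓝 x₀ := Filter.inter_mem
    (e.open_source.mem_nhds (mem_chart_source E x₀))
    ((γ t₀).continuous.continuousAt.preimage_mem_nhds
      (e'.open_source.mem_nhds (mem_chart_source E _)))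
  obtain ⟨K, hKx, hKs, hK⟩ := local_compact_nhds hs
  have hcont : ContinuousAt (fun p : T × M => e' (γ p.1 p.2)) (t₀, x₀) ∧
      ∀ᶠ p : T × M in 𝓝 (t₀, x₀), γ p.1 p.2 ∈ e'.source := by
    have hev : ∀ ε > 0, ∀ᶠ t in 𝓝 t₀, γ t ∈ weakNhd (γ t₀) e e' K 0 ε := by
      intro ε hε
      have hopen : IsOpen[smoothTopology E M] (weakNhd (γ t₀) e e' K 0 ε) :=
        TopologicalSpace.isOpen_generateFrom_of_mem ⟨γ t₀, e, e', K, 0, ε,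
          IsManifold.chart_mem_maximalAtlas x₀, IsManifold.chart_mem_maximalAtlas _, hK,
          fun x hx => (hKs hx).1, fun x hx => (hKs hx).2, hε, rfl⟩
      have hop := @IsOpen.preimage _ _ _ (smoothTopology E M) _ hγ _ hopen
      refine hop.mem_nhds ⟨fun x hx => (hKs hx).2, fun j _ x _ => ?_⟩
      simpa using hε
    refine ⟨?_, ?_⟩
    · rw [Metric.continuousAt_iff']
      intro ε hε
      have hc₀ : ContinuousAt (fun x => e' (γ t₀ x)) x₀ :=
        ContinuousAt.comp (e'.continuousAt (mem_chart_source E _))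
          (γ t₀).continuous.continuousAt
      have h1 := Metric.continuousAt_iff'.1 hc₀ (ε / 2) (half_pos hε)
      rw [nhds_prod_eq]
      filter_upwards [(hev (ε / 2) (half_pos hε)).prod_mk (h1.and hKx)] with p hp
      have h2 := hp.1.2 0 le_rfl p.2 hp.2.2
      have hl : e.symm (e p.2) = p.2 := e.left_inv (hKs hp.2.2).1
      rw [← dist_eq_norm, dist_eq_norm] at h2
      simp only [iteratedFDeriv_zero_eq_comp, Function.comp_apply, ← map_sub,
        LinearIsometryEquiv.norm_map, hl] at h2
      rw [← dist_eq_norm] at h2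
      calc dist (e' (γ p.1 p.2)) (e' (γ t₀ x₀))
          ≤ dist (e' (γ p.1 p.2)) (e' (γ t₀ p.2)) + dist (e' (γ t₀ p.2)) (e' (γ t₀ x₀)) :=
            dist_triangle _ _ _
        _ < ε / 2 + ε / 2 := add_lt_add h2 hp.2.1
        _ = ε := add_halves ε
    · rw [nhds_prod_eq]
      filter_upwards [(hev 1 one_pos).prod_mk hKx] with p hp
      exact hp.1.1 p.2 hp.2
  have h3 := (e'.continuousAt_symm (e'.map_source (mem_chart_source E (γ t₀ x₀)))).comp_of_eq
    hcont.1 rfl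
  have h4 : (fun p : T × M => γ p.1 p.2) =ᶠ[𝓝 (t₀, x₀)]
      e'.symm ∘ fun p : T × M => e' (γ p.1 p.2) := by
    filter_upwards [hcont.2] with p hp
    exact (e'.left_inv hp).symm
  exact h3.congr h4.symm

end Paths

section Global

variable {n : ℕ} {M : Type*} [TopologicalSpace M] [T2Space M]
    [SecondCountableTopology M] [ChartedSpace (EuclideanSpace ℝ (Fin (n + 1))) M]
  [IsManifold (𝓡 (n + 1)) ∞ M]

theorem isClosed_criticalSet {n : ℕ} {M : Type*} [TopologicalSpace M]
    [ChartedSpace (EuclideanSpace ℝ (Fin n)) M] [IsManifold (𝓡 n) ∞ M]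
    (α : SmoothForm (EuclideanSpace ℝ (Fin n)) M n) : IsClosed (criticalSet α) := by
  rw [← isOpen_compl_iff, isOpen_iff_mem_nhds]
  intro x hx
  set e := chartAt (EuclideanSpace ℝ (Fin n)) x with he
  have hxs : x ∈ e.source := mem_chart_source _ x
  have hrep : ∀ y ∈ e.target, FormField.rep e α.1 y ≠ 0 → α.1 (e.symm y) ≠ 0 := by
    intro y _ hy h0
    refine hy ?_
    unfold FormField.rep FormField.pull
    rw [h0]
    rfl
  have hne : FormField.rep e α.1 (e x) ≠ 0 := by
    intro h0
    refine hx ?_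
    change α.1 x = 0
    rw [← FormField.pull_rep (contMDiffOn_chart (I := 𝓡 n))
      (contMDiffOn_chart_symm (I := 𝓡 n)) α.1 hxs]
    unfold FormField.pull
    rw [h0]
    rfl
  have hc : ContinuousAt (FormField.rep e α.1 ∘ e) x :=
    ContinuousAt.comp ((α.2.contDiffAt x (e.map_source hxs)).continuousAt) (e.continuousAt hxs)
  filter_upwards [hc.eventually_ne hne, e.open_source.mem_nhds hxs] with w hw hws
  have := hrep (e w) (e.map_source hws) hw
  rwa [e.left_inv hws] at this

/-- The ends of a continuous isotopy of the pair `(M, Z)` pull back a form of top degree to forms in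
the same relative class. The form is cut into pieces `ρ_p α` with supports in the members `O p` of a
locally finite cover; the primitive that belongs to `p` vanishes at points whose track under the
isotopy misses `O p`. Tracks of compact sets being compact, these primitives form a locally finite
family and can be summed. -/
theorem exists_relative_primitive
    {Z : Set M} [ChartedSpace (EuclideanSpace ℝ (Fin n)) Z] [IsManifold (𝓡 n) ∞ Z]
    (hZ : Manifold.IsSmoothEmbedding (𝓡 n) (𝓡 (n + 1)) ∞ (Subtype.val : Z → M))
    (hZc : IsClosed Z) {γ : unitInterval → M ≃ₘ⟮𝓡 (n + 1), 𝓡 (n + 1)⟯ M}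
    (hγ : Continuous fun p : unitInterval × M => γ p.1 p.2) (hγZ : ∀ t, γ t '' Z ⊆ Z)
    (α : SmoothForm (EuclideanSpace ℝ (Fin (n + 1))) M (n + 1)) :
    ∃ β : SmoothForm (EuclideanSpace ℝ (Fin (n + 1))) M n,
      extD _ M n β = pullback (γ 1).contMDiff (n + 1) α - pullback (γ 0).contMDiff (n + 1) α ∧
      pullback hZ.contMDiff n β = 0 := by
  classical
  have : LocallyCompactSpace M :=
    ChartedSpace.locallyCompactSpace (EuclideanSpace ℝ (Fin (n + 1))) M
  choose e hpe hes hes' heZ using exists_slice_chart hZ hZc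
  choose K hK hpK hKe using fun p : M => exists_compact_subset (e p).open_source (hpe p)
  obtain ⟨O, hO, hOu, hOf, hOK⟩ := precise_refinement (fun p => interior (K p))
    (fun p => isOpen_interior) (iUnion_eq_univ_iff.2 fun p => ⟨p, hpK p⟩)
  obtain ⟨ρ, hρ⟩ := SmoothPartitionOfUnity.exists_isSubordinate (𝓡 (n + 1)) isClosed_univ O hO
    hOu.ge
  have hOe : ∀ p, O p ⊆ (e p).source := fun p => (hOK p).trans (interior_subset.trans (hKe p))
  have hρK : ∀ p, IsCompact (tsupport (ρ p)) := fun p =>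
    (hK p).of_isClosed_subset (isClosed_tsupport _)
      ((hρ p).trans ((hOK p).trans interior_subset))
  let a : M → SmoothForm (EuclideanSpace ℝ (Fin (n + 1))) M (n + 1) := fun p =>
    SmoothForm.mulFun (ρ p) (ρ p).contMDiff α
  have ha : ∀ p x, (a p).1 x = ρ p x • α.1 x := fun p x => rfl
  have ha0 : ∀ p, ∀ x ∉ tsupport (ρ p), (a p).1 x = 0 := by
    intro p x hx
    rw [ha, image_eq_zero_of_notMem_tsupport hx, zero_smul]
  have hex : ∀ p, ∃ β : SmoothForm (EuclideanSpace ℝ (Fin (n + 1))) M n,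
      extD _ M n β =
        pullback (γ 1).contMDiff (n + 1) (a p) - pullback (γ 0).contMDiff (n + 1) (a p) ∧
      pullback hZ.contMDiff n β = 0 ∧ ∀ x, (∀ t, γ t x ∉ O p) → β.1 x = 0 := by
    intro p
    obtain ⟨f, hf, hfc, hft, hfa⟩ := SmoothForm.exists_coordinate_function (a p) (hes p) (hes' p)
      (hρK p) ((hρ p).trans (hOe p)) (ha0 p)
    refine exists_primitive_of_isotopy hγ (hes p) hf hfc hfa
      (fun x hx => ha0 p x fun h => hx (hOe p (hρ p h))) hZ.contMDiff (heZ p) (fun t z => ?_)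
      (hO p) (hOe p) (hft.trans (image_mono (hρ p)))
    rw [Subtype.range_coe]
    exact hγZ t ⟨z, z.2, rfl⟩
  choose b hb1 hb2 hb3 using hex
  have hfin : ∀ x₀ : M, ∃ I : Finset M, ∀ᶠ x in 𝓝 x₀, ∀ t p, γ t x ∈ O p → p ∈ I := by
    intro x₀
    obtain ⟨C, hC, hCx⟩ := exists_compact_mem_nhds x₀
    have hcomp : IsCompact ((fun p : unitInterval × M => γ p.1 p.2) '' (univ ×ˢ C)) :=
      (isCompact_univ.prod hC).image hγ
    have hI := hOf.finite_nonempty_inter_compact hcomp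
    refine ⟨hI.toFinset, ?_⟩
    filter_upwards [hCx] with x hx t p hp
    rw [Finite.mem_toFinset]
    exact ⟨γ t x, hp, (t, x), ⟨mem_univ _, hx⟩, rfl⟩
  let B : FormField (EuclideanSpace ℝ (Fin (n + 1))) M n := fun x =>
    ∑ᶠ p, ((b p).1 x : EuclideanSpace ℝ (Fin (n + 1)) [⋀^Fin n]→L[ℝ] ℝ)
  have hBsum : ∀ (I : Finset M) x, (∀ t p, γ t x ∈ O p → p ∈ I) →
      B x = (∑ p ∈ I, b p : SmoothForm (EuclideanSpace ℝ (Fin (n + 1))) M n).1 x := by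
    intro I x hI
    rw [SmoothForm.sum_apply]
    refine finsum_eq_sum_of_support_subset _ fun p hp => ?_
    by_contra hpI
    exact hp (hb3 p x fun t ht => hpI (hI t p ht))
  have hBs : B.IsSmooth := FormField.isSmooth_of_eventually_eq fun x₀ => by
    obtain ⟨I, hI⟩ := hfin x₀
    exact ⟨_, (∑ p ∈ I, b p).2, hI.mono fun x hx => hBsum I x hx⟩
  have hasum : ∀ (I : Finset M) x, (∀ p, x ∈ O p → p ∈ I) →
      (∑ p ∈ I, a p : SmoothForm (EuclideanSpace ℝ (Fin (n + 1))) M (n + 1)).1 x = α.1 x := by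
    intro I x hI
    rw [SmoothForm.sum_apply]
    simp only [ha]
    rw [← Finset.sum_smul, ρ.sum_finsupport' (x₀ := x) (mem_univ x) ?_, one_smul]
    intro p hp
    rw [ρ.mem_finsupport] at hp
    exact hI p (hρ p (subset_tsupport _ hp))
  refine ⟨⟨B, hBs⟩, Subtype.ext (funext fun x₀ => ?_), Subtype.ext (funext fun z => ?_)⟩
  · obtain ⟨I, hI⟩ := hfin x₀
    have h1 : B.d x₀ = (extD _ M n (∑ p ∈ I, b p)).1 x₀ :=
      FormField.d_congr (hI.mono fun x hx => hBsum I x hx)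
    have h2 : extD _ M n (∑ p ∈ I, b p) = pullback (γ 1).contMDiff (n + 1) (∑ p ∈ I, a p) -
        pullback (γ 0).contMDiff (n + 1) (∑ p ∈ I, a p) := by
      rw [map_sum, map_sum, map_sum, ← Finset.sum_sub_distrib]
      exact Finset.sum_congr rfl fun p _ => hb1 p
    have h3 : ∀ t, (pullback (γ t).contMDiff (n + 1) (∑ p ∈ I, a p)).1 x₀ =
        (pullback (γ t).contMDiff (n + 1) α).1 x₀ := by
      intro t
      change FormField.pull (γ t) (∑ p ∈ I, a p).1 x₀ = FormField.pull (γ t) α.1 x₀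
      unfold FormField.pull
      rw [hasum I (γ t x₀) fun p hp => hI.self_of_nhds t p hp]
    change B.d x₀ = _
    rw [h1, h2]
    exact congrArg₂ (· - ·) (h3 1) (h3 0)
  · change (B z).compContinuousLinearMap _ = 0
    obtain ⟨I, hI⟩ := hfin z
    rw [hBsum I z hI.self_of_nhds]
    have h1 : pullback hZ.contMDiff n (∑ p ∈ I, b p) = 0 := by
      rw [map_sum]
      exact Finset.sum_eq_zero fun p _ => hb2 p
    exact congrFun (congrArg Subtype.val h1) z

end Global

end FoldedVolume

theorem mainTheorem2 (n : ℕ) {M : Type*} [TopologicalSpace M] [T2Space M]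
    [SecondCountableTopology M] [ChartedSpace (EuclideanSpace ℝ (Fin (n + 1))) M]
    [IsManifold (𝓡 (n + 1)) ∞ M]
    (Z : Set M) [ChartedSpace (EuclideanSpace ℝ (Fin n)) Z] [IsManifold (𝓡 n) ∞ Z]
    (hZ : Manifold.IsSmoothEmbedding (𝓡 n) (𝓡 (n + 1)) ∞ (Subtype.val : Z → M))
    (Ω₀ Ω₁ : FoldedVolume.SmoothForm (EuclideanSpace ℝ (Fin (n + 1))) M (n + 1))
    (h₀ : FoldedVolume.IsFolded Ω₀) (h₁ : FoldedVolume.IsFolded Ω₁)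
    (hZ₀ : FoldedVolume.criticalSet Ω₀ = Z) (hZ₁ : FoldedVolume.criticalSet Ω₁ = Z)
    (φ : FoldedVolume.DiffPair (EuclideanSpace ℝ (Fin (n + 1))) Z)
    (hφ : φ ∈ pathComponent (FoldedVolume.DiffPair.identity (EuclideanSpace ℝ (Fin (n + 1))) Z))
    (hΩ : FoldedVolume.pullback φ.1.contMDiff (n + 1) Ω₁ = Ω₀) :
    FoldedVolume.topClass Ω₀ = FoldedVolume.topClass Ω₁ ∧
      FoldedVolume.topRelClass hZ.contMDiff Ω₀ = FoldedVolume.topRelClass hZ.contMDiff Ω₁ := by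
  have : LocallyCompactSpace M :=
    ChartedSpace.locallyCompactSpace (EuclideanSpace ℝ (Fin (n + 1))) M
  obtain ⟨γ⟩ := hφ
  have hγ := FoldedVolume.continuous_eval_of_continuous_smoothTopology
    (γ := fun t => (γ t).1)
    (@Continuous.comp _ _ _ _ _ (FoldedVolume.smoothTopology (EuclideanSpace ℝ (Fin (n + 1))) M)
      _ _ continuous_induced_dom γ.continuous)
  obtain ⟨β, hβ, hβZ⟩ := FoldedVolume.exists_relative_primitive hZ
    (hZ₁ ▸ FoldedVolume.isClosed_criticalSet Ω₁) hγ (fun t => (γ t).2.le) Ω₁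
  have hβ' : FoldedVolume.extD (EuclideanSpace ℝ (Fin (n + 1))) M n β = Ω₀ - Ω₁ := by
    rw [hβ]
    refine congrArg₂ (· - ·) ?_ ?_
    · rw [← hΩ]
      refine Subtype.ext ?_
      change FoldedVolume.FormField.pull (γ 1).1 Ω₁.1 = FoldedVolume.FormField.pull φ.1 Ω₁.1
      rw [γ.target]
    · refine Subtype.ext (funext fun x => ?_)
      change FoldedVolume.FormField.pull (γ 0).1 Ω₁.1 x = Ω₁.1 x
      rw [γ.source]
      exact congrFun (FoldedVolume.FormField.pull_id Ω₁.1) x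
  refine ⟨(Submodule.Quotient.eq _).2 ⟨β, hβ'⟩, (Submodule.Quotient.eq _).2 ⟨β, hβZ, hβ'⟩⟩
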